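/- **Setting.** Let $X$ be a locally compact Hausdorff space. For a space $Y$ let $\Phi(Y)$ be the set of lower semicontinuous functions $\psi:Y\to(-\infty,\infty]$ that are $\ge 0$ unless $Y$ is compact. Measures on $X$ are Radon measures. For positive $\nu,\nu'$ put $\kappa(x,\nu)=\int\kappa(x,y)\,d\nu(y)$ and $\kappa(\nu,\nu')=\int\kappa\,d(\nu\otimes\nu')$. Let $\kappa\in\Phi(X\times X)$ be a positive definite kernel: $\kappa(x,y)=\kappa(y,x)$, and the energy $\kappa(\nu_1,\nu_1)+\kappa(\nu_2,\nu_2)-2\kappa(\nu_1,\nu_2)$ of every real Radon measure $\nu_1-\nu_2$ ($\nu_1,\nu_2\ge 0$) is nonnegative whenever it is defined. For compact $K$ let $C(K)=1/\inf\kappa(\nu,\nu)$, the infimum being over positive $\nu$ supported by $K$ with $\nu(K)=1$ (and $\inf\varnothing=\infty$). The interior capacity of $E\subset X$ is $C(E)=\sup\{C(K):K\subset E\text{ compact}\}$. A property holds *nearly everywhere* (n.e.) in $E$ if the set of $x\in E$ where it fails has interior capacity $0$. For a function $\psi$ that is bounded from below n.e. in $E$, where $C(E)>0$, put $$\operatorname*{\text{“inf”}}_{x\in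 E}\psi(x):=\sup\{q\in\mathbb R:\ \psi(x)\ge q\ \text{ n.e. in }E\}$$ (at points where $\psi$ is undefined the inequality counts as failing). Let $I$ be a countable index set and let $\mathbf A=(A_i)_{i\in I}$ be nonempty closed subsets of $X$ with signs $\alpha_i\in\{1,-1\}$ such that every compact set meets only finitely many $A_i$, and $A_i\cap A_j=\varnothing$ whenever $\alpha_i\ne\alpha_j$. Let $a_i>0$, let $g_i:A_i\to(0,\infty)$ be continuous, and let $f_i=f_{i1}-f_{i2}$ (defined where this is not $\infty-\infty$), where $f_{i1},f_{i2}\in\Phi(X)$ and $f_{i2}\ne\infty$ n.e. in $X$. For a vector measure $\mu=(\mu^i)_{i\in I}$, where $\mu^i$ is a positive Radon measure supported by $A_i$, put $$\kappa(\mu,\mu)=\sum_{i,j\in I}\alpha_i\alpha_j\kappa(\mu^i,\mu^j),\quad W^i_\mu(x)=\sum_{j\in I}\alpha_i\alpha_j\kappa(x,\mu^j)+f_i(x),\quad \langle \mathbf f,\mu\rangle=\sum_{i\in I}\int f_i\,d\mu^i,$$ $$G_{\mathbf f}(\mu)=\kappa(\mu,\mu)+2\langle\mathbf f,\mu\rangle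 ,$$ where infinite sums are unconditional, so that a sum is finite if and only if it converges absolutely. Let $\mathcal E_{\mathbf f}$ be the class of those $\mu$ with $\kappa(\mu,\mu)$ finite, $\langle\mathbf f,\mu\rangle$ finite, and $\int g_i\,d\mu^i=a_i$ for all $i\in I$. An *equilibrium measure* is an element $\lambda\in\mathcal E_{\mathbf f}$ with $G_{\mathbf f}(\lambda)\le G_{\mathbf f}(\mu)$ for all $\mu\in\mathcal E_{\mathbf f}$. **Statement.** Let $\lambda$ be an equilibrium measure. For every $i\in I$ we have $C(A_i)>0$, the function $a_iW^i_\lambda/g_i$ is bounded from below n.e. in $A_i$, the integral $\langle W^i_\lambda,\lambda^i\rangle:=\int W^i_\lambda\,d\lambda^i$ is defined and finite, and $$\langle W^i_\lambda,\lambda^i\rangle=\operatorname*{\text{“inf”}}_{x\in A_i}\frac{a_iW^i_\lambda(x)}{g_i(x)} .$$ Consequently, the following sum converges absolutely and $$G_{\mathbf f}(\lambda)=\sum_{i\in I}\operatorname*{\text{“inf”}}_{x\in A_i}\frac{a_iW^i_\lambda(x)}{g_i(x)}+\langle\mathbf f,\lambda\rangle .$$ -/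

import Mathlib

open MeasureTheory
open scoped ENNReal

noncomputable section

namespace GaussProblem

/-! Extended integrals and sums. Functions and families take values in `EReal`; a function that is
only partially defined is given by a total function together with its domain `D`. -/

section Extended

variable {X : Type*} [MeasurableSpace X] {ι : Type*}

/-- `∫ u dν = ∫ u⁺ dν - ∫ u⁻ dν`; meaningful if one of the two integrals is finite. -/
def eint (ν : Measure X) (u : X → EReal) : EReal :=
  ((∫⁻ x, (u x).toENNReal ∂ν : ℝ≥0∞) : EReal) - ((∫⁻ x, (-u x).toENNReal ∂ν : ℝ≥0∞) : EReal)

/-- `∫ u dν` is defined and finite: `u` (with domain `D`) is defined `ν`-almost everywhere and both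
`∫ u⁺ dν` and `∫ u⁻ dν` are finite. -/
def EIntFinite (ν : Measure X) (D : Set X) (u : X → EReal) : Prop :=
  (∀ᵐ x ∂ν, x ∈ D) ∧ (∫⁻ x, (u x).toENNReal ∂ν) ≠ ⊤ ∧ (∫⁻ x, (-u x).toENNReal ∂ν) ≠ ⊤

/-- `∑ u i = ∑ (u i)⁺ - ∑ (u i)⁻`; meaningful if one of the two sums is finite. -/
def esum (u : ι → EReal) : EReal :=
  ((∑' i, (u i).toENNReal : ℝ≥0∞) : EReal) - ((∑' i, (-u i).toENNReal : ℝ≥0∞) : EReal)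

/-- The sum `∑ u i` is well defined in the extended reals. -/
def ESumDefined (u : ι → EReal) : Prop :=
  (∑' i, (u i).toENNReal) ≠ ⊤ ∨ (∑' i, (-u i).toENNReal) ≠ ⊤

/-- The sum `∑ u i` is well defined and finite, that is, absolutely convergent. -/
def ESumFinite (u : ι → EReal) : Prop :=
  (∑' i, (u i).toENNReal) ≠ ⊤ ∧ (∑' i, (-u i).toENNReal) ≠ ⊤

end Extended

/-- The class `Φ(Y)`: lower semicontinuous functions `ψ : Y → (-∞, ∞]` that are nonnegative
unless `Y` is compact. -/
def IsPhi {Y : Type*} [TopologicalSpace Y] (ψ : Y → EReal) : Prop :=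
  LowerSemicontinuous ψ ∧ (∀ y, ψ y ≠ ⊥) ∧ (¬ CompactSpace Y → ∀ y, 0 ≤ ψ y)

/-! Scalar potential theory. A positive Radon measure is a Borel measure `ν` with `ν.Regular`. -/

section Scalar

variable {X : Type*} [TopologicalSpace X] [MeasurableSpace X]

/-- The potential `κ(x, ν) = ∫ κ(x, y) dν(y)`. -/
def pot (κ : X → X → EReal) (ν : Measure X) (x : X) : EReal :=
  eint ν (fun y => κ x y)

/-- The mutual energy `κ(ν, ν') = ∫ κ d(ν ⊗ ν')` of two positive Radon measures. It is written as
an iterated integral, which for a kernel in `Φ(X × X)` is the integral against the product Radon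
measure (the product of the Borel `σ`-algebras may be too small to carry that measure when `X`
is not second countable). -/
def energy (κ : X → X → EReal) (ν ν' : Measure X) : EReal :=
  eint ν (fun x => pot κ ν' x)

/-- A positive definite kernel: a symmetric element `κ` of `Φ(X × X)` such that the energy
`κ(ν, ν) = κ(ν₁, ν₁) + κ(ν₂, ν₂) - 2 κ(ν₁, ν₂)` of every real Radon measure `ν = ν₁ - ν₂`
(with `ν₁`, `ν₂` positive) is nonnegative whenever it is defined, that is, not of the
form `∞ - ∞`. -/
structure IsPosDefKernel (κ : X → X → EReal) : Prop where
  phi : IsPhi (fun p : X × X => κ p.1 p.2)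
  symm : ∀ x y, κ x y = κ y x
  energy_nonneg : ∀ ν₁ ν₂ : Measure X, ν₁.Regular → ν₂.Regular →
    ¬ (energy κ ν₁ ν₁ + energy κ ν₂ ν₂ = ⊤ ∧ energy κ ν₁ ν₂ = ⊤) →
    0 ≤ energy κ ν₁ ν₁ + energy κ ν₂ ν₂ - 2 * energy κ ν₁ ν₂

/-- The capacity of a compact set `K`: the reciprocal of the infimum of `κ(ν, ν)` over all positive
Radon measures `ν` supported by `K` with `ν(K) = 1`. -/
def compactCapacity (κ : X → X → EReal) (K : Set X) : ℝ≥0∞ :=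
  (⨅ (ν : Measure X) (_ : ν.Regular ∧ ν Kᶜ = 0 ∧ ν K = 1), (energy κ ν ν).toENNReal)⁻¹

/-- The interior capacity `C(E)`: the supremum of the capacities of the compact subsets of `E`. -/
def interiorCapacity (κ : X → X → EReal) (E : Set X) : ℝ≥0∞ :=
  ⨆ (K : Set X) (_ : IsCompact K ∧ K ⊆ E), compactCapacity κ K

/-- `P x` holds nearly everywhere (n.e.) in `E`. -/
def NearlyEverywhere (κ : X → X → EReal) (E : Set X) (P : X → Prop) : Prop :=
  interiorCapacity κ {x | x ∈ E ∧ ¬ P x} = 0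

/-- The function `ψ` with domain `D` is bounded from below nearly everywhere in `E`. -/
def NEBddBelow (κ : X → X → EReal) (E D : Set X) (ψ : X → EReal) : Prop :=
  ∃ q : ℝ, NearlyEverywhere κ E (fun x => x ∈ D ∧ (q : EReal) ≤ ψ x)

/-- The n.e. infimum `sup {q : ψ(x) ≥ q n.e. in E}` of a function `ψ` with domain `D`. -/
def neInf (κ : X → X → EReal) (E D : Set X) (ψ : X → EReal) : EReal :=
  sSup ((fun q : ℝ => (q : EReal)) ''
    {q : ℝ | NearlyEverywhere κ E (fun x => x ∈ D ∧ (q : EReal) ≤ ψ x)})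

end Scalar

/-- A condenser: nonempty closed plates with signs `±1`, such that every compact set meets at most
finitely many plates and oppositely signed plates are disjoint. -/
structure Condenser (X ι : Type*) [TopologicalSpace X] where
  plate : ι → Set X
  sign : ι → ℝ
  sign_eq : ∀ i, sign i = 1 ∨ sign i = -1
  nonempty : ∀ i, (plate i).Nonempty
  closed : ∀ i, IsClosed (plate i)
  locallyFinite : ∀ K : Set X, IsCompact K → {i | (plate i ∩ K).Nonempty}.Finite
  disjoint : ∀ i j, sign i = 1 → sign j = -1 → Disjoint (plate i) (plate j)

/-- The two functions `f_{i1}`, `f_{i2}` in `Φ(X)` whose difference is the external field `f_i`. -/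
structure ExternalField (X ι : Type*) [TopologicalSpace X] where
  fst : ι → X → EReal
  snd : ι → X → EReal
  fst_phi : ∀ i, IsPhi (fst i)
  snd_phi : ∀ i, IsPhi (snd i)

section Vector

variable {X ι : Type*} [TopologicalSpace X] [MeasurableSpace X]

/-- The external field `f_i = f_{i1} - f_{i2}`, considered on `ExternalField.dom`. -/
def ExternalField.val (f : ExternalField X ι) (i : ι) (x : X) : EReal :=
  f.fst i x - f.snd i x

/-- The set where `f_i = f_{i1} - f_{i2}` is defined, that is, not of the form `∞ - ∞`. -/
def ExternalField.dom (f : ExternalField X ι) (i : ι) : Set X :=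
  {x | ¬ (f.fst i x = ⊤ ∧ f.snd i x = ⊤)}

/-- `μ = (μ^i)` belongs to `𝔐(A)`: each `μ^i` is a positive Radon measure supported by `A_i`. -/
def IsVectorMeasure (A : Condenser X ι) (μ : ι → Measure X) : Prop :=
  ∀ i, (μ i).Regular ∧ μ i (A.plate i)ᶜ = 0

/-- The terms `α_i α_j κ(μ^i, μ^j)` of the energy of a vector measure. -/
def energyTerm (κ : X → X → EReal) (A : Condenser X ι) (μ : ι → Measure X) (p : ι × ι) : EReal :=
  ((A.sign p.1 * A.sign p.2 : ℝ) : EReal) * energy κ (μ p.1) (μ p.2)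

/-- The energy `κ(μ, μ) = ∑_{i,j} α_i α_j κ(μ^i, μ^j)` of a vector measure. -/
def vectorEnergy (κ : X → X → EReal) (A : Condenser X ι) (μ : ι → Measure X) : EReal :=
  esum (energyTerm κ A μ)

/-- The terms `α_i α_j κ(x, μ^j)` of the `i`-th component of the vector potential. -/
def potTerm (κ : X → X → EReal) (A : Condenser X ι) (μ : ι → Measure X) (i : ι) (x : X)
    (j : ι) : EReal :=
  ((A.sign i * A.sign j : ℝ) : EReal) * pot κ (μ j) x

/-- The `i`-th component `κ_μ^i(x) = ∑_j α_i α_j κ(x, μ^j)` of the vector potential. -/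
def vectorPot (κ : X → X → EReal) (A : Condenser X ι) (μ : ι → Measure X) (i : ι) (x : X) :
    EReal :=
  esum (potTerm κ A μ i x)

/-- The `i`-th component `W_μ^i = κ_μ^i + f_i` of the weighted potential,
considered on `weightedDom`. -/
def weightedPot (κ : X → X → EReal) (A : Condenser X ι) (f : ExternalField X ι)
    (μ : ι → Measure X) (i : ι) (x : X) : EReal :=
  vectorPot κ A μ i x + f.val i x

/-- The set where `W_μ^i = κ_μ^i + f_i` is defined: both summands are defined and they are not
infinite of opposite signs. -/
def weightedDom (κ : X → X → EReal) (A : Condenser X ι) (f : ExternalField X ι)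
    (μ : ι → Measure X) (i : ι) : Set X :=
  {x | ESumDefined (potTerm κ A μ i x) ∧ x ∈ f.dom i ∧
    ¬ (vectorPot κ A μ i x = ⊤ ∧ f.val i x = ⊥) ∧ ¬ (vectorPot κ A μ i x = ⊥ ∧ f.val i x = ⊤)}

/-- `⟨f, μ⟩ = ∑_i ∫ f_i dμ^i`. -/
def pairing (f : ExternalField X ι) (μ : ι → Measure X) : EReal :=
  esum (fun i => eint (μ i) (f.val i))

/-- `⟨f, μ⟩` is defined and finite. -/
def PairingFinite (f : ExternalField X ι) (μ : ι → Measure X) : Prop :=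
  (∀ i, EIntFinite (μ i) (f.dom i) (f.val i)) ∧ ESumFinite (fun i => eint (μ i) (f.val i))

/-- The weighted energy `G_f(μ) = κ(μ, μ) + 2 ⟨f, μ⟩`. -/
def weightedEnergy (κ : X → X → EReal) (A : Condenser X ι) (f : ExternalField X ι)
    (μ : ι → Measure X) : EReal :=
  vectorEnergy κ A μ + 2 * pairing f μ

/-- The class `ℰ_f(A, a, g)`: vector measures of finite energy with `∫ g_i dμ^i = a_i` for all `i`
and `⟨f, μ⟩` finite. Only the values of `g_i` on `A_i` matter. -/
structure IsAdmissible (κ : X → X → EReal) (A : Condenser X ι) (a : ι → ℝ) (g : ι → X → ℝ)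
    (f : ExternalField X ι) (μ : ι → Measure X) : Prop where
  vectorMeasure : IsVectorMeasure A μ
  finiteEnergy : ESumFinite (energyTerm κ A μ)
  normalized : ∀ i, ∫⁻ x in A.plate i, ENNReal.ofReal (g i x) ∂(μ i) = ENNReal.ofReal (a i)
  finitePairing : PairingFinite f μ

/-- The class `𝒢_f(A, a, g)` of equilibrium measures: the minimizers of `G_f` over
`ℰ_f(A, a, g)`. -/
def IsEquilibrium (κ : X → X → EReal) (A : Condenser X ι) (a : ι → ℝ) (g : ι → X → ℝ)
    (f : ExternalField X ι) (μ : ι → Measure X) : Prop :=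
  IsAdmissible κ A a g f μ ∧
    ∀ ν : ι → Measure X, IsAdmissible κ A a g f ν →
      weightedEnergy κ A f μ ≤ weightedEnergy κ A f ν

/-- The n.e. infimum over `A_i` of `a_i W_μ^i / g_i`. -/
def plateInf (κ : X → X → EReal) (A : Condenser X ι) (a : ι → ℝ) (g : ι → X → ℝ)
    (f : ExternalField X ι) (μ : ι → Measure X) (i : ι) : EReal :=
  neInf κ (A.plate i) (weightedDom κ A f μ i)
    (fun x => (a i : EReal) * weightedPot κ A f μ i x / (g i x : EReal))

end Vector

end GaussProblem

end

/-!
An equilibrium measure `μ` minimizes a quadratic functional on a convex class, so each admissible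
variation of one component has a nonnegative derivative. Write `w_i = ∫ W_μ^i dμ^i`. If
`a_i W_μ^i / g_i ≥ w_i` failed on a subset of `A_i` of positive capacity, a compact part of that
subset would carry a measure `τ` of finite energy with bounded external field and
`∫ g_i dτ = a_i`; moving `μ^i` slightly towards `τ` is admissible and has derivative
`2 (∫ W_μ^i dτ - w_i) < 0`, contradicting minimality (`KernelShift.weightedPairing_le`,
`KernelShift.nearlyEverywhere_weightedPairing_le`). Conversely a nearly everywhere lower bound `q`
holds `μ^i`-almost everywhere, because measures of finite energy do not charge sets of capacity
zero; integrating it against `g_i dμ^i / a_i` gives `q ≤ w_i`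
(`KernelShift.le_weightedPairing_of_nearlyEverywhere`). Hence the nearly everywhere infimum is
`w_i`, and summing `w_i` over `i` gives the formula for the weighted energy
(`KernelShift.weightedEnergy_eq`).

That the potentials of infinitely many components are defined off a set of capacity zero, and that
they may be integrated termwise against `τ`, rests on positive definiteness: it bounds twice the
mutual energy of `τ` and a finite sum of components by the energy of `τ` plus the energy of that
sum, and the latter is at most the absolutely convergent total energy
(`KernelShift.tsum_inter_ne_top_of_finite_energy`).

The computations use a nonnegative kernel that differs from `κ` by a constant, which is nonzero
only if `X` is compact, when the measures are finite and there are finitely many plates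
(`KernelShift`). The space need not be second countable, so `κ` need not be measurable for the
product `σ`-algebra. The measurability of potentials and the symmetry of the mutual energy come
instead from the `τ`-additivity of regular measures
(`lintegral_iSup_of_directed_lowerSemicontinuous`).
-/

set_option linter.unusedSectionVars false

noncomputable section

namespace GaussProblem

open Set Filter Topology
open scoped NNReal

section LowerSemicontinuous

/-! ### Directed suprema of lower semicontinuous functions -/

lemma sum_indicator_succ_lt_le (y : ℝ≥0∞) (m : ℕ) :
    ∑ k ∈ Finset.range m, (if ((k : ℝ≥0∞) + 1) < y then (1 : ℝ≥0∞) else 0) ≤ min (m : ℝ≥0∞) y := by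
  induction m with
  | zero => simp
  | succ m ih =>
    rw [Finset.sum_range_succ]
    split_ifs with h
    · rw [min_eq_left (by push_cast; exact h.le)]
      push_cast
      gcongr
      exact ih.trans (min_le_left _ _)
    · rw [add_zero]
      exact ih.trans (min_le_min (by push_cast; exact le_self_add) le_rfl)

lemma tsum_indicator_succ_lt_le (y : ℝ≥0∞) :
    ∑' k : ℕ, (if ((k : ℝ≥0∞) + 1) < y then (1 : ℝ≥0∞) else 0) ≤ y := by
  rw [ENNReal.tsum_eq_iSup_nat]
  exact iSup_le fun m => (sum_indicator_succ_lt_le y m).trans (min_le_right _ _)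

lemma le_tsum_indicator_succ_lt_add_one (y : ℝ≥0∞) :
    y ≤ ∑' k : ℕ, (if ((k : ℝ≥0∞) + 1) < y then (1 : ℝ≥0∞) else 0) + 1 := by
  have key : ∀ n : ℕ, (n : ℝ≥0∞) < y →
      (n : ℝ≥0∞) ≤ ∑' k : ℕ, (if ((k : ℝ≥0∞) + 1) < y then (1 : ℝ≥0∞) else 0) := by
    intro n hn
    refine le_trans ?_ (ENNReal.sum_le_tsum (Finset.range n))
    rw [Finset.sum_congr rfl (g := fun _ => (1 : ℝ≥0∞))]
    · simp
    · intro k hk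
      rw [if_pos]
      refine lt_of_le_of_lt ?_ hn
      exact_mod_cast Finset.mem_range.1 hk
  refine le_of_forall_lt fun b hb => ?_
  have hb' : b ≠ ⊤ := (hb.trans_le le_top).ne
  by_contra! hcon
  -- the largest natural number `n ≤ b` satisfies `n < y` and `b < n + 1`
  have h1 : ((⌊b.toNNReal⌋₊ : ℕ) : ℝ≥0∞) ≤ b := by
    conv_rhs => rw [← ENNReal.coe_toNNReal hb']
    exact_mod_cast Nat.floor_le b.toNNReal.2
  have h2 : b < ((⌊b.toNNReal⌋₊ : ℕ) : ℝ≥0∞) + 1 := by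
    conv_lhs => rw [← ENNReal.coe_toNNReal hb']
    exact_mod_cast Nat.lt_floor_add_one b.toNNReal
  have h3 := key _ (h1.trans_lt hb)
  exact absurd (h2.trans_le (add_le_add_left h3 1)) (not_lt.2 hcon)

variable {X : Type*} [TopologicalSpace X] [MeasurableSpace X] [BorelSpace X]

lemma measure_iUnion_of_directed_isOpen {ι : Type*} [Nonempty ι] (ν : Measure X) [ν.Regular]
    {U : ι → Set X} (hU : ∀ i, IsOpen (U i)) (hd : Directed (· ⊆ ·) U) :
    ν (⋃ i, U i) = ⨆ i, ν (U i) := by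
  refine le_antisymm (le_of_forall_lt fun r hr => ?_)
    (iSup_le fun i => measure_mono (subset_iUnion U i))
  obtain ⟨K, hKU, hK, hrK⟩ := (isOpen_iUnion hU).exists_lt_isCompact hr
  obtain ⟨i, hi⟩ := hK.elim_directed_cover U hU hKU hd
  exact hrK.trans_le ((measure_mono hi).trans (le_iSup (fun i => ν (U i)) i))

/-- A lower approximation of `y` of mesh `2⁻ⁿ`: `2⁻ⁿ` times the number of `k ≥ 1` with
`k 2⁻ⁿ < y`. Strict inequalities make the level sets of `dyadicSum n ∘ h` open if `h` is lower
semicontinuous. -/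
def dyadicSum (n : ℕ) (y : ℝ≥0∞) : ℝ≥0∞ :=
  (2 ^ n)⁻¹ * ∑' k : ℕ, (if ((k : ℝ≥0∞) + 1) < 2 ^ n * y then (1 : ℝ≥0∞) else 0)

lemma two_pow_inv_mul_cancel (n : ℕ) (y : ℝ≥0∞) : ((2 : ℝ≥0∞) ^ n)⁻¹ * (2 ^ n * y) = y := by
  rw [← mul_assoc, ENNReal.inv_mul_cancel (by simp) (by finiteness), one_mul]

lemma dyadicSum_le (n : ℕ) (y : ℝ≥0∞) : dyadicSum n y ≤ y := by
  unfold dyadicSum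
  calc _ ≤ (2 ^ n)⁻¹ * (2 ^ n * y) := by gcongr; exact tsum_indicator_succ_lt_le _
    _ = y := two_pow_inv_mul_cancel n y

lemma le_dyadicSum_add (n : ℕ) (y : ℝ≥0∞) : y ≤ dyadicSum n y + (2 ^ n)⁻¹ := by
  unfold dyadicSum
  calc y = (2 ^ n)⁻¹ * (2 ^ n * y) := (two_pow_inv_mul_cancel n y).symm
    _ ≤ (2 ^ n)⁻¹ * (_ + 1) := by gcongr; exact le_tsum_indicator_succ_lt_add_one _
    _ = _ := by rw [mul_add, mul_one]

lemma le_liminf_dyadicSum (y : ℝ≥0∞) : y ≤ liminf (fun n => dyadicSum n y) atTop := by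
  have h0 : Tendsto (fun n : ℕ => ((2 : ℝ≥0∞) ^ n)⁻¹) atTop (𝓝 0) := by
    simp_rw [ENNReal.inv_pow]
    exact ENNReal.tendsto_pow_atTop_nhds_zero_of_lt_one (by norm_num)
  refine le_of_forall_lt fun b hb => ?_
  obtain ⟨b', hbb', hb'y⟩ := exists_between hb
  refine hbb'.trans_le (le_liminf_of_le (by isBoundedDefault) ?_)
  have hpos : 0 < y - b' := tsub_pos_of_lt hb'y
  filter_upwards [h0.eventually_lt_const hpos] with n hn
  have h1 : b' + (2 ^ n)⁻¹ < y := by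
    rw [add_comm]
    exact lt_tsub_iff_right.1 hn
  by_contra! hcon
  exact absurd (h1.trans_le (le_dyadicSum_add n y)) (not_lt.2 (add_le_add_left hcon.le _))

lemma dyadicSum_measurable {h : X → ℝ≥0∞} (hh : Measurable h) (n : ℕ) :
    Measurable fun x => dyadicSum n (h x) := by
  unfold dyadicSum
  refine Measurable.const_mul (Measurable.tsum fun k => ?_) _
  exact Measurable.ite (measurableSet_lt measurable_const (hh.const_mul _)) measurable_const
    measurable_const

lemma lintegral_dyadicSum (ν : Measure X) {h : X → ℝ≥0∞} (hh : Measurable h) (n : ℕ) :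
    ∫⁻ x, dyadicSum n (h x) ∂ν =
      (2 ^ n)⁻¹ * ∑' k : ℕ, ν {x | ((k : ℝ≥0∞) + 1) < 2 ^ n * h x} := by
  unfold dyadicSum
  have hm : ∀ k : ℕ, MeasurableSet {x | ((k : ℝ≥0∞) + 1) < 2 ^ n * h x} := fun k =>
    measurableSet_lt measurable_const (hh.const_mul _)
  have hm' : ∀ k : ℕ, Measurable fun x =>
      (if ((k : ℝ≥0∞) + 1) < 2 ^ n * h x then (1 : ℝ≥0∞) else 0) := fun k =>
    Measurable.ite (hm k) measurable_const measurable_const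
  rw [lintegral_const_mul _ (Measurable.tsum hm'),
    lintegral_tsum fun k => (hm' k).aemeasurable]
  congr 2
  ext k
  have : (fun x => (if ((k : ℝ≥0∞) + 1) < 2 ^ n * h x then (1 : ℝ≥0∞) else 0)) =
      indicator {x | ((k : ℝ≥0∞) + 1) < 2 ^ n * h x} 1 := by
    ext x; simp [indicator_apply]
  rw [this, lintegral_indicator_one (hm k)]

lemma isOpen_lt_const_mul {h : X → ℝ≥0∞} (hh : LowerSemicontinuous h) (b : ℝ≥0∞) (n : ℕ) :
    IsOpen {x | b < 2 ^ n * h x} := by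
  have : {x | b < 2 ^ n * h x} = h ⁻¹' Ioi (b / 2 ^ n) := by
    ext x
    simp only [mem_ofPred_eq, mem_preimage, mem_Ioi]
    rw [ENNReal.div_lt_iff (by simp) (by left; finiteness), mul_comm]
  rw [this]
  exact hh.isOpen_preimage _

/-- Regular measures are `τ`-additive: integration commutes with suprema of upward directed,
possibly uncountable families of lower semicontinuous functions. -/
theorem lintegral_iSup_of_directed_lowerSemicontinuous {ι : Type*} [Nonempty ι] (ν : Measure X)
    [ν.Regular] {h : ι → X → ℝ≥0∞} (hh : ∀ i, LowerSemicontinuous (h i))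
    (hd : Directed (· ≤ ·) h) :
    ∫⁻ x, ⨆ i, h i x ∂ν = ⨆ i, ∫⁻ x, h i x ∂ν := by
  refine le_antisymm ?_ (iSup_le fun i => lintegral_mono fun x => le_iSup (fun i => h i x) i)
  have hs : LowerSemicontinuous fun x => ⨆ i, h i x := lowerSemicontinuous_iSup hh
  -- Fatou's lemma reduces the claim to the dyadic sums
  refine (lintegral_mono fun x => le_liminf_dyadicSum _).trans
    ((lintegral_liminf_le fun n => dyadicSum_measurable hs.measurable n).trans ?_)
  refine liminf_le_of_le (by isBoundedDefault) fun b hb => ?_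
  obtain ⟨n, hn⟩ := hb.exists
  refine hn.trans ?_
  rw [lintegral_dyadicSum ν hs.measurable, ENNReal.tsum_eq_iSup_sum, ENNReal.mul_iSup]
  refine iSup_le fun s => ?_
  have hU : ∀ k : ℕ, ν {x | ((k : ℝ≥0∞) + 1) < 2 ^ n * ⨆ i, h i x} =
      ⨆ i, ν {x | ((k : ℝ≥0∞) + 1) < 2 ^ n * h i x} := by
    intro k
    rw [← measure_iUnion_of_directed_isOpen ν fun i => isOpen_lt_const_mul (hh i) _ n]
    · congr 1
      ext x
      simp [ENNReal.mul_iSup, lt_iSup_iff]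
    · intro i j
      obtain ⟨l, hil, hjl⟩ := hd i j
      exact ⟨l, fun x hx => lt_of_lt_of_le hx (mul_le_mul' le_rfl (hil x)),
        fun x hx => lt_of_lt_of_le hx (mul_le_mul' le_rfl (hjl x))⟩
  simp_rw [hU]
  rw [ENNReal.finsetSum_iSup, ENNReal.mul_iSup]
  · refine iSup_le fun i => (le_trans ?_ (lintegral_mono fun x => dyadicSum_le n (h i x))).trans
      (le_iSup (fun i => ∫⁻ x, h i x ∂ν) i)
    rw [lintegral_dyadicSum ν (hh i).measurable]
    gcongr
    exact ENNReal.sum_le_tsum s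
  · intro i j
    obtain ⟨l, hil, hjl⟩ := hd i j
    exact ⟨l, fun k => ⟨measure_mono fun x hx => lt_of_lt_of_le hx (mul_le_mul' le_rfl (hil x)),
      measure_mono fun x hx => lt_of_lt_of_le hx (mul_le_mul' le_rfl (hjl x))⟩⟩

/-! ### Lower semicontinuous kernels -/

/-- The continuous, compactly supported, nonnegative real functions below `h`. -/
def ccBelow {Z : Type*} [TopologicalSpace Z] (h : Z → ℝ≥0∞) : Set (Z → ℝ) :=
  {φ | Continuous φ ∧ HasCompactSupport φ ∧ 0 ≤ φ ∧ ∀ z, ENNReal.ofReal (φ z) ≤ h z}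

lemma zero_mem_ccBelow {Z : Type*} [TopologicalSpace Z] (h : Z → ℝ≥0∞) : 0 ∈ ccBelow h :=
  ⟨continuous_const, HasCompactSupport.zero, le_rfl, by simp⟩

instance {Z : Type*} [TopologicalSpace Z] (h : Z → ℝ≥0∞) : Nonempty (ccBelow h) :=
  ⟨⟨0, zero_mem_ccBelow h⟩⟩

lemma sup_mem_ccBelow {Z : Type*} [TopologicalSpace Z] {h : Z → ℝ≥0∞} {φ ψ : Z → ℝ}
    (hφ : φ ∈ ccBelow h) (hψ : ψ ∈ ccBelow h) : φ ⊔ ψ ∈ ccBelow h := by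
  refine ⟨hφ.1.sup hψ.1, ?_, le_sup_of_le_left hφ.2.2.1, fun z => ?_⟩
  · refine (hφ.2.1.union hψ.2.1).of_isClosed_subset (isClosed_tsupport _) ?_
    rw [tsupport, tsupport, tsupport, ← closure_union]
    refine closure_mono fun z hz => ?_
    by_contra hcon
    simp only [mem_union, Function.mem_support, not_or, not_not] at hcon
    exact hz (by simp [hcon.1, hcon.2])
  · rw [Pi.sup_apply, ENNReal.ofReal_max]
    exact max_le (hφ.2.2.2 z) (hψ.2.2.2 z)

/-- On a locally compact Hausdorff space, a nonnegative lower semicontinuous function is the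
supremum of the functions in `C_c` below it. -/
lemma iSup_ccBelow {Z : Type*} [TopologicalSpace Z] [T2Space Z] [LocallyCompactSpace Z]
    {h : Z → ℝ≥0∞} (hh : LowerSemicontinuous h) (z : Z) :
    ⨆ φ : ccBelow h, ENNReal.ofReal (φ.1 z) = h z := by
  refine le_antisymm (iSup_le fun φ => φ.2.2.2.2 z) (le_of_forall_lt fun b hb => ?_)
  obtain ⟨t, hbt, htz⟩ := ENNReal.lt_iff_exists_nnreal_btwn.1 hb
  obtain ⟨ψ, hψ1, hψ0, hψc, hψI⟩ := exists_continuous_one_zero_of_isCompact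
    (isCompact_singleton (x := z)) (hh.isOpen_preimage (t : ℝ≥0∞)).isClosed_compl
    (disjoint_compl_right_iff_subset.2 (singleton_subset_iff.2 htz))
  refine hbt.trans_le (le_iSup_of_le ⟨fun x => t * ψ x, by fun_prop, hψc.mul_left, fun x =>
    mul_nonneg t.2 (hψI x).1, fun x => ?_⟩ ?_)
  · by_cases hx : (t : ℝ≥0∞) < h x
    · refine le_trans ?_ hx.le
      rw [ENNReal.ofReal_le_iff_le_toReal (by simp), ENNReal.coe_toReal]
      exact mul_le_of_le_one_right t.2 (hψI x).2
    · have : ψ x = 0 := hψ0 hx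
      simp [this]
  · have : ψ z = 1 := hψ1 rfl
    simp [this]

variable [T2Space X] [LocallyCompactSpace X]

lemma continuous_integral_of_hasCompactSupport (ν : Measure X) [ν.Regular] {φ : X × X → ℝ}
    (hφ : Continuous φ) (hc : HasCompactSupport φ) :
    Continuous fun x => ∫ y, φ (x, y) ∂ν := by
  rw [← continuousOn_univ]
  refine continuousOn_integral_of_compact_support (IsCompact.image hc continuous_snd)
    (f := fun x y => φ (x, y)) hφ.continuousOn fun p x _ hx => ?_
  by_contra hne
  exact hx ⟨(p, x), subset_tsupport _ hne, rfl⟩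

lemma integrable_section (ν : Measure X) [ν.Regular] {φ : X × X → ℝ} (hφ : Continuous φ)
    (hc : HasCompactSupport φ) (x : X) : Integrable (fun y => φ (x, y)) ν := by
  have hcont : Continuous fun y => φ (x, y) := hφ.comp (by fun_prop)
  refine hcont.integrable_of_hasCompactSupport ?_
  refine HasCompactSupport.intro (IsCompact.image hc continuous_snd) fun y hy => ?_
  by_contra hne
  exact hy ⟨(x, y), subset_tsupport _ hne, rfl⟩

lemma lintegral_eq_iSup_ccBelow (ν : Measure X) [ν.Regular] {K : X → X → ℝ≥0∞}
    (hK : LowerSemicontinuous fun p : X × X => K p.1 p.2) (x : X) :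
    ∫⁻ y, K x y ∂ν = ⨆ φ : ccBelow (fun p : X × X => K p.1 p.2),
      ENNReal.ofReal (∫ y, φ.1 (x, y) ∂ν) := by
  have h1 : ∀ y, K x y = ⨆ φ : ccBelow (fun p : X × X => K p.1 p.2),
      ENNReal.ofReal (φ.1 (x, y)) := fun y => (iSup_ccBelow hK (x, y)).symm
  simp_rw [h1]
  rw [lintegral_iSup_of_directed_lowerSemicontinuous]
  · congr 1
    ext φ
    exact (ofReal_integral_eq_lintegral_ofReal (integrable_section ν φ.2.1 φ.2.2.1 x)
      (Eventually.of_forall fun y => φ.2.2.2.1 _)).symm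
  · intro φ
    exact (ENNReal.continuous_ofReal.comp (φ.2.1.comp (by fun_prop))).lowerSemicontinuous
  · intro φ ψ
    exact ⟨⟨_, sup_mem_ccBelow φ.2 ψ.2⟩, fun y => ENNReal.ofReal_le_ofReal le_sup_left,
      fun y => ENNReal.ofReal_le_ofReal le_sup_right⟩

lemma lowerSemicontinuous_lintegral (ν : Measure X) [ν.Regular] {K : X → X → ℝ≥0∞}
    (hK : LowerSemicontinuous fun p : X × X => K p.1 p.2) :
    LowerSemicontinuous fun x => ∫⁻ y, K x y ∂ν := by
  simp_rw [lintegral_eq_iSup_ccBelow ν hK]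
  exact lowerSemicontinuous_iSup fun φ => (ENNReal.continuous_ofReal.comp
    (continuous_integral_of_hasCompactSupport ν φ.2.1 φ.2.2.1)).lowerSemicontinuous

lemma hasCompactSupport_integral (ν : Measure X) {φ : X × X → ℝ} (hc : HasCompactSupport φ) :
    HasCompactSupport fun x => ∫ y, φ (x, y) ∂ν := by
  refine HasCompactSupport.intro (IsCompact.image hc continuous_fst) fun x hx => ?_
  have : ∀ y, φ (x, y) = 0 := by
    intro y
    by_contra hne
    exact hx ⟨(x, y), subset_tsupport _ hne, rfl⟩
  simp [this]

lemma lintegral_lintegral_eq_iSup_ccBelow (μ ν : Measure X) [μ.Regular] [ν.Regular]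
    {K : X → X → ℝ≥0∞} (hK : LowerSemicontinuous fun p : X × X => K p.1 p.2) :
    ∫⁻ x, ∫⁻ y, K x y ∂ν ∂μ = ⨆ φ : ccBelow (fun p : X × X => K p.1 p.2),
      ENNReal.ofReal (∫ x, ∫ y, φ.1 (x, y) ∂ν ∂μ) := by
  simp_rw [lintegral_eq_iSup_ccBelow ν hK]
  rw [lintegral_iSup_of_directed_lowerSemicontinuous]
  · congr 1
    ext φ
    exact (ofReal_integral_eq_lintegral_ofReal
      ((continuous_integral_of_hasCompactSupport ν φ.2.1
        φ.2.2.1).integrable_of_hasCompactSupport (hasCompactSupport_integral ν φ.2.2.1))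
      (Eventually.of_forall fun x => integral_nonneg fun y => φ.2.2.2.1 _)).symm
  · exact fun φ => (ENNReal.continuous_ofReal.comp
      (continuous_integral_of_hasCompactSupport ν φ.2.1 φ.2.2.1)).lowerSemicontinuous
  · intro φ ψ
    refine ⟨⟨_, sup_mem_ccBelow φ.2 ψ.2⟩, fun x => ENNReal.ofReal_le_ofReal ?_,
      fun x => ENNReal.ofReal_le_ofReal ?_⟩
    · exact integral_mono (integrable_section ν φ.2.1 φ.2.2.1 x)
        (integrable_section ν (sup_mem_ccBelow φ.2 ψ.2).1 (sup_mem_ccBelow φ.2 ψ.2).2.1 x)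
        fun y => le_sup_left
    · exact integral_mono (integrable_section ν ψ.2.1 ψ.2.2.1 x)
        (integrable_section ν (sup_mem_ccBelow φ.2 ψ.2).1 (sup_mem_ccBelow φ.2 ψ.2).2.1 x)
        fun y => le_sup_right

/-- Tonelli's theorem for a symmetric lower semicontinuous kernel and two regular measures.
Neither `σ`-finiteness of the measures nor measurability of the kernel for the product `σ`-algebra
is needed, since the kernel is a directed supremum of functions in `C_c`. -/
theorem lintegral_lintegral_swap_of_lowerSemicontinuous (μ ν : Measure X) [μ.Regular] [ν.Regular]
    {K : X → X → ℝ≥0∞} (hK : LowerSemicontinuous fun p : X × X => K p.1 p.2)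
    (hs : ∀ x y, K x y = K y x) :
    ∫⁻ x, ∫⁻ y, K x y ∂ν ∂μ = ∫⁻ x, ∫⁻ y, K x y ∂μ ∂ν := by
  have key : ∀ (μ ν : Measure X) [μ.Regular] [ν.Regular],
      ∫⁻ x, ∫⁻ y, K x y ∂ν ∂μ ≤ ∫⁻ x, ∫⁻ y, K x y ∂μ ∂ν := by
    intro μ ν _ _
    rw [lintegral_lintegral_eq_iSup_ccBelow μ ν hK, lintegral_lintegral_eq_iSup_ccBelow ν μ hK]
    refine iSup_le fun φ => le_iSup_of_le ⟨φ.1 ∘ Prod.swap, φ.2.1.comp continuous_swap,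
      φ.2.2.1.comp_homeomorph (Homeomorph.prodComm X X), fun z => φ.2.2.2.1 z.swap, fun z => ?_⟩ ?_
    · exact (φ.2.2.2.2 z.swap).trans (hs _ _).le
    · refine ENNReal.ofReal_le_ofReal (le_of_eq ?_)
      exact integral_integral_swap_of_hasCompactSupport (f := fun x y => φ.1 (x, y))
        φ.2.1 φ.2.2.1
  exact le_antisymm (key μ ν) (key ν μ)

end LowerSemicontinuous

/-! ### Extended integrals and sums -/

lemma coe_sub_coe_eq_of_add_eq {a b p n : ℝ≥0∞} (h : a + n = p + b) (hn : n ≠ ⊤)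
    (hb : b ≠ ⊤) : (a : EReal) - (b : EReal) = (p : EReal) - (n : EReal) := by
  lift n to ℝ≥0 using hn
  lift b to ℝ≥0 using hb
  induction a with
  | top =>
    have : p = ⊤ := by
      by_contra hp
      rw [top_add] at h
      exact (ENNReal.add_lt_top.2 ⟨lt_top_iff_ne_top.2 hp, ENNReal.coe_lt_top⟩).ne h.symm
    subst this
    simp only [EReal.coe_ennreal_top]
    rw [← EReal.coe_ennreal_top]
    simp [EReal.coe_nnreal_eq_coe_real]
  | coe a =>
    have hp : p ≠ ⊤ := by
      rintro rfl
      rw [top_add] at h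
      exact (ENNReal.add_lt_top.2 ⟨ENNReal.coe_lt_top, ENNReal.coe_lt_top⟩).ne h
    lift p to ℝ≥0 using hp
    have h' : (a : ℝ) + n = p + b := by exact_mod_cast h
    simp only [EReal.coe_nnreal_eq_coe_real]
    rw [← EReal.coe_sub, ← EReal.coe_sub]
    congr 1
    linarith

lemma coe_sub_coe_eq_coe_toReal {a b : ℝ≥0∞} (ha : a ≠ ⊤) (hb : b ≠ ⊤) :
    (a : EReal) - (b : EReal) = ((a.toReal - b.toReal : ℝ) : EReal) := by
  rw [EReal.coe_sub, EReal.coe_ennreal_toReal ha, EReal.coe_ennreal_toReal hb]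

lemma toENNReal_coe_sub_coe (p n : ℝ≥0∞) :
    ((p : EReal) - (n : EReal)).toENNReal = p - n := by
  rw [EReal.toENNReal_sub (EReal.coe_ennreal_nonneg n), EReal.toENNReal_coe, EReal.toENNReal_coe]

lemma neg_coe_sub_coe {p n : ℝ≥0∞} (hn : n ≠ ⊤) :
    -((p : EReal) - (n : EReal)) = (n : EReal) - (p : EReal) := by
  rw [EReal.neg_sub (Or.inl (EReal.coe_ennreal_ne_bot p)) (Or.inr (by simpa using hn)), add_comm,
    sub_eq_add_neg]

section Integrals

variable {X : Type*} [MeasurableSpace X] {ι : Type*}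

/-- The extended integral may be computed from any decomposition of the integrand as a difference
of nonnegative functions, provided the subtracted one is integrable. -/
lemma eint_coe_sub_coe {ν : Measure X} {p n : X → ℝ≥0∞} (hp : Measurable p) (hn : Measurable n)
    (hfin : ∫⁻ x, n x ∂ν ≠ ⊤) :
    eint ν (fun x => (p x : EReal) - (n x : EReal)) =
      ((∫⁻ x, p x ∂ν : ℝ≥0∞) : EReal) - ((∫⁻ x, n x ∂ν : ℝ≥0∞) : EReal) := by
  have hae : ∀ᵐ x ∂ν, n x ≠ ⊤ := (ae_lt_top hn hfin).mono fun x hx => hx.ne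
  have h1 : ∫⁻ x, ((p x : EReal) - (n x : EReal)).toENNReal ∂ν = ∫⁻ x, (p x - n x) ∂ν := by
    simp_rw [toENNReal_coe_sub_coe]
  have h2 : ∫⁻ x, (-((p x : EReal) - (n x : EReal))).toENNReal ∂ν = ∫⁻ x, (n x - p x) ∂ν :=
    lintegral_congr_ae (hae.mono fun x hx => by
      simp only [neg_coe_sub_coe hx, toENNReal_coe_sub_coe])
  unfold eint
  rw [h1, h2]
  refine coe_sub_coe_eq_of_add_eq ?_ hfin
    (ne_top_of_le_ne_top hfin (lintegral_mono fun x => tsub_le_self))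
  rw [← lintegral_add_right _ hn, ← lintegral_add_left hp]
  exact lintegral_congr fun x => by rw [tsub_add_eq_max, add_tsub_eq_max]

lemma eint_of_integrable {ν : Measure X} {u : X → EReal} {r : X → ℝ} (hr : Integrable r ν)
    (h : u =ᵐ[ν] fun x => (r x : EReal)) :
    (∫⁻ x, (u x).toENNReal ∂ν) ≠ ⊤ ∧ (∫⁻ x, (-u x).toENNReal ∂ν) ≠ ⊤ ∧
      eint ν u = ((∫ x, r x ∂ν : ℝ) : EReal) := by
  have h1 : ∫⁻ x, (u x).toENNReal ∂ν = ∫⁻ x, ENNReal.ofReal (r x) ∂ν :=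
    lintegral_congr_ae (h.mono fun x hx => by simp only [hx, EReal.real_coe_toENNReal])
  have h2 : ∫⁻ x, (-u x).toENNReal ∂ν = ∫⁻ x, ENNReal.ofReal (-r x) ∂ν :=
    lintegral_congr_ae (h.mono fun x hx => by
      simp only [hx, ← EReal.coe_neg, EReal.real_coe_toENNReal])
  have h3 : ∫⁻ x, ENNReal.ofReal (r x) ∂ν ≠ ⊤ := hr.lintegral_lt_top.ne
  have h4 : ∫⁻ x, ENNReal.ofReal (-r x) ∂ν ≠ ⊤ := hr.neg.lintegral_lt_top.ne
  refine ⟨h1 ▸ h3, h2 ▸ h4, ?_⟩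
  unfold eint
  rw [h1, h2, coe_sub_coe_eq_coe_toReal h3 h4,
    integral_eq_lintegral_pos_part_sub_lintegral_neg_part hr]

lemma integrable_toReal_of_lintegral_ne_top {ν : Measure X} {u : X → EReal}
    (hm : AEStronglyMeasurable (fun x => (u x).toReal) ν)
    (hp : (∫⁻ x, (u x).toENNReal ∂ν) ≠ ⊤) (hn : (∫⁻ x, (-u x).toENNReal ∂ν) ≠ ⊤) :
    Integrable (fun x => (u x).toReal) ν := by
  refine ⟨hm, ?_⟩
  have h1 : ∀ x, ‖(u x).toReal‖ₑ =
      ENNReal.ofReal (u x).toReal + ENNReal.ofReal (-(u x).toReal) := by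
    intro x
    rw [Real.enorm_eq_ofReal_abs]
    rcases le_total 0 (u x).toReal with h | h
    · rw [abs_of_nonneg h, ENNReal.ofReal_of_nonpos (neg_nonpos.2 h), add_zero]
    · rw [abs_of_nonpos h, ENNReal.ofReal_of_nonpos h, zero_add]
  have hle : ∀ t : EReal, ENNReal.ofReal t.toReal ≤ t.toENNReal := by
    intro t
    induction t with
    | bot => simp
    | top => simp
    | coe r => simp
  rw [hasFiniteIntegral_def]
  simp_rw [h1]
  rw [lintegral_add_left' hm.aemeasurable.ennreal_ofReal, ENNReal.add_lt_top]
  refine ⟨(lintegral_mono fun x => hle (u x)).trans_lt hp.lt_top,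
    (lintegral_mono fun x => ?_).trans_lt hn.lt_top⟩
  simpa using hle (-u x)

lemma esum_of_summable {r : ι → ℝ} (h : Summable r) :
    ESumFinite (fun i => (r i : EReal)) ∧
      esum (fun i => (r i : EReal)) = ((∑' i, r i : ℝ) : EReal) := by
  have hp : Summable fun i => max (r i) 0 := by
    refine Summable.of_nonneg_of_le (fun i => le_max_right _ _) (fun i => ?_) h.abs
    exact max_le (le_abs_self _) (abs_nonneg _)
  have hn : Summable fun i => max (-r i) 0 := by
    refine Summable.of_nonneg_of_le (fun i => le_max_right _ _) (fun i => ?_) h.abs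
    exact max_le (neg_le_abs _) (abs_nonneg _)
  have h1 : ∑' i, ((r i : EReal)).toENNReal = ENNReal.ofReal (∑' i, max (r i) 0) := by
    rw [ENNReal.ofReal_tsum_of_nonneg (fun i => le_max_right _ _) hp]
    simp [ENNReal.ofReal_max]
  have h2 : ∑' i, (-(r i : EReal)).toENNReal = ENNReal.ofReal (∑' i, max (-r i) 0) := by
    rw [ENNReal.ofReal_tsum_of_nonneg (fun i => le_max_right _ _) hn]
    simp [ENNReal.ofReal_max, ← EReal.coe_neg]
  refine ⟨⟨by rw [h1]; exact ENNReal.ofReal_ne_top, by rw [h2]; exact ENNReal.ofReal_ne_top⟩, ?_⟩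
  unfold esum
  rw [h1, h2, coe_sub_coe_eq_coe_toReal ENNReal.ofReal_ne_top ENNReal.ofReal_ne_top,
    ENNReal.toReal_ofReal (tsum_nonneg fun i => le_max_right _ _),
    ENNReal.toReal_ofReal (tsum_nonneg fun i => le_max_right _ _), ← hp.tsum_sub hn]
  congr 2
  ext i
  rcases le_total 0 (r i) with h | h
  · rw [max_eq_left h, max_eq_right (by linarith), sub_zero]
  · rw [max_eq_right h, max_eq_left (by linarith), zero_sub, neg_neg]

lemma ESumFinite.exists_summable {u : ι → EReal} (h : ESumFinite u) :
    ∃ r : ι → ℝ, Summable r ∧ ∀ i, u i = (r i : EReal) := by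
  have htop : ∀ i, u i ≠ ⊤ := fun i hi =>
    ENNReal.ne_top_of_tsum_ne_top h.1 i (by rw [hi, EReal.toENNReal_top])
  have hbot : ∀ i, u i ≠ ⊥ := fun i hi =>
    ENNReal.ne_top_of_tsum_ne_top h.2 i (by rw [hi, EReal.neg_bot, EReal.toENNReal_top])
  refine ⟨fun i => (u i).toReal, ?_, fun i => (EReal.coe_toReal (htop i) (hbot i)).symm⟩
  have h1 := ENNReal.summable_toReal h.1
  have h2 := ENNReal.summable_toReal h.2
  refine (h1.sub h2).congr fun i => ?_
  obtain ⟨r, hr⟩ : ∃ r : ℝ, u i = r := ⟨_, (EReal.coe_toReal (htop i) (hbot i)).symm⟩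
  rw [hr, ← EReal.coe_neg, EReal.real_coe_toENNReal, EReal.real_coe_toENNReal, EReal.toReal_coe,
    ENNReal.toReal_ofReal', ENNReal.toReal_ofReal']
  rcases le_total 0 r with h | h
  · rw [max_eq_left h, max_eq_right (by linarith), sub_zero]
  · rw [max_eq_right h, max_eq_left (by linarith), zero_sub, neg_neg]

end Integrals

/-! ### Sums of regular measures -/

section Regular

variable {X : Type*} [TopologicalSpace X] [MeasurableSpace X] [BorelSpace X]

instance Measure.Regular.add (μ ν : Measure X) [μ.Regular] [ν.Regular] : (μ + ν).Regular where
  lt_top_of_isCompact K hK := by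
    rw [Measure.add_apply, ENNReal.add_lt_top]
    exact ⟨hK.measure_lt_top, hK.measure_lt_top⟩
  outerRegular A _ r hr := by
    rw [Measure.add_apply] at hr
    obtain ⟨s, t, hs, ht, hst⟩ : ∃ s t, μ A < s ∧ ν A < t ∧ s + t ≤ r := by
      obtain ⟨b, hb1, hb2⟩ := exists_between hr
      have hμ : μ A ≠ ⊤ := ne_top_of_le_ne_top hr.ne_top le_self_add
      have hν : ν A ≠ ⊤ := ne_top_of_le_ne_top hr.ne_top le_add_self
      have hd : (r - (μ A + ν A)) / 2 ≠ 0 := (ENNReal.half_pos (tsub_pos_of_lt hr).ne').ne'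
      refine ⟨μ A + (r - (μ A + ν A)) / 2, ν A + (r - (μ A + ν A)) / 2,
        ENNReal.lt_add_right hμ hd, ENNReal.lt_add_right hν hd, le_of_eq ?_⟩
      rw [add_add_add_comm, ENNReal.add_halves, add_tsub_cancel_of_le hr.le]
    obtain ⟨U, hAU, hU, hUs⟩ := A.exists_isOpen_lt_of_lt s hs
    obtain ⟨V, hAV, hV, hVt⟩ := A.exists_isOpen_lt_of_lt t ht
    refine ⟨U ∩ V, subset_inter hAU hAV, hU.inter hV, ?_⟩
    rw [Measure.add_apply]
    refine lt_of_lt_of_le (ENNReal.add_lt_add ?_ ?_) hst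
    · exact (measure_mono inter_subset_left).trans_lt hUs
    · exact (measure_mono inter_subset_right).trans_lt hVt
  innerRegular U hU r hr := by
    rw [Measure.add_apply] at hr
    rcases eq_or_ne (μ U) 0 with h | h
    · rw [h, zero_add] at hr
      obtain ⟨K, hKU, hK, hrK⟩ := hU.exists_lt_isCompact hr
      exact ⟨K, hKU, hK, hrK.trans_le (by simp)⟩
    rcases eq_or_ne (ν U) 0 with h' | h'
    · rw [h', add_zero] at hr
      obtain ⟨K, hKU, hK, hrK⟩ := hU.exists_lt_isCompact hr
      exact ⟨K, hKU, hK, hrK.trans_le (by simp)⟩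
    obtain ⟨u, hu, v, hv, huv⟩ := ENNReal.exists_lt_add_of_lt_add hr h h'
    obtain ⟨K, hKU, hK, huK⟩ := hU.exists_lt_isCompact hu
    obtain ⟨L, hLU, hL, hvL⟩ := hU.exists_lt_isCompact hv
    refine ⟨K ∪ L, union_subset hKU hLU, hK.union hL, huv.trans_le ?_⟩
    rw [Measure.add_apply]
    exact add_le_add (huK.le.trans (measure_mono subset_union_left))
      (hvL.le.trans (measure_mono subset_union_right))

instance Measure.Regular.finsetSum {ι : Type*} (s : Finset ι) (μ : ι → Measure X)
    [∀ i, (μ i).Regular] : (∑ i ∈ s, μ i).Regular := by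
  classical
  induction s using Finset.induction_on with
  | empty => rw [Finset.sum_empty]; infer_instance
  | insert i s hi ih => rw [Finset.sum_insert hi]; infer_instance

end Regular

/-! ### Making the kernel nonnegative -/

section Shift

variable {X : Type*} [TopologicalSpace X]

/-- A nonnegative lower semicontinuous symmetric kernel `ker` with `κ = ker - c²`, where the
constant `c` vanishes unless `X` is compact. Writing the constant as a square makes the correction
term of the mutual energy the product of two masses. -/
structure KernelShift (κ : X → X → EReal) where
  ker : X → X → ℝ≥0∞
  c : ℝ≥0
  lsc : LowerSemicontinuous fun p : X × X => ker p.1 p.2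
  symm : ∀ x y, ker x y = ker y x
  eq : ∀ x y, κ x y = (ker x y : EReal) - (((c * c : ℝ≥0) : ℝ≥0∞) : EReal)
  c_eq_zero_or : c = 0 ∨ CompactSpace X

lemma lowerSemicontinuous_toENNReal_add {Y : Type*} [TopologicalSpace Y] {ψ : Y → EReal}
    (hψ : LowerSemicontinuous ψ) (r : ℝ) :
    LowerSemicontinuous fun y => (ψ y + (r : EReal)).toENNReal := by
  have hc : Continuous fun t : EReal => (t + (r : EReal)).toENNReal := by
    refine EReal.continuous_toENNReal.comp (continuous_iff_continuousAt.2 fun t => ?_)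
    exact (EReal.continuousAt_add (p := (t, (r : EReal))) (Or.inr (EReal.coe_ne_bot r))
      (Or.inr (EReal.coe_ne_top r))).comp (f := fun t : EReal => (t, (r : EReal))) (by fun_prop)
  exact hc.comp_lowerSemicontinuous hψ fun s t hst =>
    EReal.toENNReal_le_toENNReal (add_le_add_left hst _)

lemma IsPhi.exists_neg_sq_le {Y : Type*} [TopologicalSpace Y] {ψ : Y → EReal} (hψ : IsPhi ψ) :
    ∃ c : ℝ≥0, (c = 0 ∨ CompactSpace Y) ∧ ∀ y, ((-(c * c : ℝ) : ℝ) : EReal) ≤ ψ y := by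
  by_cases hY : CompactSpace Y
  · rcases isEmpty_or_nonempty Y with hE | hne
    · exact ⟨0, Or.inr hY, fun y => (hE.false y).elim⟩
    · obtain ⟨z, -, hz⟩ := (hψ.1.lowerSemicontinuousOn univ).exists_isMinOn univ_nonempty
        isCompact_univ
      obtain ⟨r, -, hr⟩ := EReal.lt_iff_exists_real_btwn.1 (bot_lt_iff_ne_bot.2 (hψ.2.1 z))
      refine ⟨1 + ⟨|r|, abs_nonneg r⟩, Or.inr hY, fun y => le_trans ?_ (hz (mem_univ y))⟩
      refine le_trans ?_ hr.le
      rw [EReal.coe_le_coe_iff]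
      change -((1 + |r|) * (1 + |r|)) ≤ r
      nlinarith [neg_abs_le r, abs_nonneg r]
  · exact ⟨0, Or.inl rfl, fun y => by simpa using hψ.2.2 hY y⟩

lemma IsPosDefKernel.exists_kernelShift [MeasurableSpace X] {κ : X → X → EReal}
    (hκ : IsPosDefKernel κ) : Nonempty (KernelShift κ) := by
  obtain ⟨c, hc, hle⟩ := hκ.phi.exists_neg_sq_le
  refine ⟨⟨fun x y => (κ x y + ((c * c : ℝ) : EReal)).toENNReal, c,
    lowerSemicontinuous_toENNReal_add hκ.phi.1 (c * c), fun x y => by rw [hκ.symm],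
    fun x y => ?_, ?_⟩⟩
  · have h0 : 0 ≤ κ x y + ((c * c : ℝ) : EReal) := by
      have h1 := add_le_add_left (hle (x, y)) (((c * c : ℝ)) : EReal)
      rwa [← EReal.coe_add, neg_add_cancel, EReal.coe_zero] at h1
    rw [EReal.coe_toENNReal h0, EReal.coe_nnreal_eq_coe_real]
    push_cast
    rw [← EReal.coe_mul]
    exact (EReal.add_sub_cancel_right (b := (c * c : ℝ))).symm
  · rcases hc with h | h
    · exact Or.inl h
    · rcases isEmpty_or_nonempty X with hE | ⟨⟨x⟩⟩
      · exact Or.inr inferInstance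
      · exact Or.inr (Function.Surjective.compactSpace (f := (Prod.fst : X × X → X))
          continuous_fst fun y => ⟨(y, x), rfl⟩)

/-! ### Mutual energies -/

namespace KernelShift

variable [T2Space X] [LocallyCompactSpace X] [MeasurableSpace X] [BorelSpace X]
  {κ : X → X → EReal} (S : KernelShift κ)

/-- The potential of `ν` for the nonnegative kernel. -/
def pot (ν : Measure X) (x : X) : ℝ≥0∞ := ∫⁻ y, S.ker x y ∂ν

/-- The mutual energy of `μ` and `ν` for the nonnegative kernel. -/
def inter (μ ν : Measure X) : ℝ≥0∞ := ∫⁻ x, S.pot ν x ∂μ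

/-- The total mass of `ν` scaled by `c`; it is `0` if `c = 0`, even for infinite measures. -/
def mass (ν : Measure X) : ℝ≥0∞ := S.c * ν univ

/-- The mutual energy for `κ` as a real number, for measures with `S.inter μ ν ≠ ⊤`. -/
def realEnergy (μ ν : Measure X) : ℝ := (S.inter μ ν).toReal - (S.mass μ).toReal * (S.mass ν).toReal

lemma mass_ne_top (ν : Measure X) [ν.Regular] : S.mass ν ≠ ⊤ := by
  rcases S.c_eq_zero_or with h | h
  · simp [mass, h]
  · exact ENNReal.mul_ne_top ENNReal.coe_ne_top isCompact_univ.measure_ne_top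

lemma lowerSemicontinuous_pot (ν : Measure X) [ν.Regular] : LowerSemicontinuous (S.pot ν) :=
  lowerSemicontinuous_lintegral ν S.lsc

lemma measurable_pot (ν : Measure X) [ν.Regular] : Measurable (S.pot ν) :=
  (S.lowerSemicontinuous_pot ν).measurable

lemma measurable_ker (x : X) : Measurable (S.ker x) :=
  (S.lsc.comp (g := fun y => (x, y)) (by fun_prop)).measurable

lemma pot_eq (ν : Measure X) [ν.Regular] (x : X) :
    GaussProblem.pot κ ν x = (S.pot ν x : EReal) - ((S.c * S.mass ν : ℝ≥0∞) : EReal) := by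
  have h : ∫⁻ _ : X, ((S.c * S.c : ℝ≥0) : ℝ≥0∞) ∂ν = S.c * S.mass ν := by
    rw [lintegral_const, mass, ENNReal.coe_mul, mul_assoc]
  unfold GaussProblem.pot
  simp_rw [S.eq]
  rw [eint_coe_sub_coe (S.measurable_ker x) measurable_const, h, pot]
  rw [h]
  exact ENNReal.mul_ne_top ENNReal.coe_ne_top (S.mass_ne_top ν)

lemma energy_eq (μ ν : Measure X) [μ.Regular] [ν.Regular] :
    energy κ μ ν = (S.inter μ ν : EReal) - ((S.mass μ * S.mass ν : ℝ≥0∞) : EReal) := by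
  have h : ∫⁻ _ : X, (S.c * S.mass ν) ∂μ = S.mass μ * S.mass ν := by
    rw [lintegral_const, mass, mass]; ring
  unfold energy
  simp_rw [S.pot_eq]
  rw [eint_coe_sub_coe (S.measurable_pot ν) measurable_const, h, inter]
  rw [h]
  exact ENNReal.mul_ne_top (S.mass_ne_top μ) (S.mass_ne_top ν)

lemma energy_eq_coe {μ ν : Measure X} [μ.Regular] [ν.Regular] (h : S.inter μ ν ≠ ⊤) :
    energy κ μ ν = (S.realEnergy μ ν : EReal) := by
  rw [S.energy_eq, coe_sub_coe_eq_coe_toReal h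
    (ENNReal.mul_ne_top (S.mass_ne_top μ) (S.mass_ne_top ν)), ENNReal.toReal_mul, realEnergy]

lemma energy_eq_top_iff {μ ν : Measure X} [μ.Regular] [ν.Regular] :
    energy κ μ ν = ⊤ ↔ S.inter μ ν = ⊤ := by
  constructor
  · intro h
    by_contra hne
    rw [S.energy_eq_coe hne] at h
    exact EReal.coe_ne_top _ h
  · intro h
    have h2 : S.mass μ * S.mass ν ≠ ⊤ := ENNReal.mul_ne_top (S.mass_ne_top μ) (S.mass_ne_top ν)
    rw [S.energy_eq, h, ← EReal.coe_ennreal_toReal h2, EReal.coe_ennreal_top, EReal.top_sub_coe]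

lemma inter_comm (μ ν : Measure X) [μ.Regular] [ν.Regular] : S.inter μ ν = S.inter ν μ :=
  lintegral_lintegral_swap_of_lowerSemicontinuous μ ν S.lsc S.symm

lemma inter_add_left (μ₁ μ₂ ν : Measure X) :
    S.inter (μ₁ + μ₂) ν = S.inter μ₁ ν + S.inter μ₂ ν := lintegral_add_measure _ _ _

lemma inter_smul_left (t : ℝ≥0) (μ ν : Measure X) : S.inter (t • μ) ν = t * S.inter μ ν := by
  unfold inter
  rw [lintegral_smul_measure]
  rfl

lemma inter_finset_sum_left {ι : Type*} (s : Finset ι) (μ : ι → Measure X) (ν : Measure X) :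
    S.inter (∑ i ∈ s, μ i) ν = ∑ i ∈ s, S.inter (μ i) ν := lintegral_finsetSum_measure _ _ _

lemma inter_mono {μ μ' ν ν' : Measure X} (hμ : μ ≤ μ') (hν : ν ≤ ν') :
    S.inter μ ν ≤ S.inter μ' ν' :=
  lintegral_mono' hμ fun _ => lintegral_mono' hν le_rfl

lemma mass_add (μ ν : Measure X) : S.mass (μ + ν) = S.mass μ + S.mass ν := by
  simp [mass, mul_add]

lemma mass_smul (t : ℝ≥0) (μ : Measure X) : S.mass (t • μ) = t * S.mass μ := by
  simp only [mass, Measure.smul_apply, ENNReal.smul_def, smul_eq_mul]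
  ring

/-- Positive definiteness, in the form that the mutual energy of two measures is at most the mean
of their energies. -/
lemma two_mul_inter_le (hκ : IsPosDefKernel κ) (μ ν : Measure X) [μ.Regular] [ν.Regular] :
    2 * S.inter μ ν ≤ S.inter μ μ + S.inter ν ν := by
  by_cases hμ : S.inter μ μ = ⊤
  · simp [hμ]
  by_cases hν : S.inter ν ν = ⊤
  · simp [hν]
  have hpd := hκ.energy_nonneg μ ν inferInstance inferInstance
  rw [S.energy_eq_coe hμ, S.energy_eq_coe hν, ← EReal.coe_add] at hpd
  specialize hpd fun h => EReal.coe_ne_top _ h.1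
  have hμν : S.inter μ ν ≠ ⊤ := by
    intro h
    rw [S.energy_eq_top_iff.2 h, EReal.mul_top_of_pos (by norm_num), EReal.sub_top] at hpd
    exact absurd hpd (by simp)
  rw [S.energy_eq_coe hμν] at hpd
  have hpd' : 0 ≤ S.realEnergy μ μ + S.realEnergy ν ν - 2 * S.realEnergy μ ν := by
    rw [← EReal.coe_nonneg]
    exact hpd
  rw [← ENNReal.toReal_le_toReal (by finiteness) (by finiteness), ENNReal.toReal_mul,
    ENNReal.toReal_add hμ hν]
  unfold realEnergy at hpd'
  -- the correction terms for the two masses add up to minus a square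
  simp only [ENNReal.toReal_ofNat]
  nlinarith [sq_nonneg ((S.mass μ).toReal - (S.mass ν).toReal)]

lemma realEnergy_comm (μ ν : Measure X) [μ.Regular] [ν.Regular] :
    S.realEnergy μ ν = S.realEnergy ν μ := by
  rw [realEnergy, realEnergy, S.inter_comm, mul_comm]

lemma realEnergy_comb_left {s t : ℝ≥0} {μ₁ μ₂ ν : Measure X} [μ₁.Regular] [μ₂.Regular]
    (h₁ : S.inter μ₁ ν ≠ ⊤) (h₂ : S.inter μ₂ ν ≠ ⊤) :
    S.realEnergy (s • μ₁ + t • μ₂) ν = s * S.realEnergy μ₁ ν + t * S.realEnergy μ₂ ν := by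
  have := S.mass_ne_top μ₁
  have := S.mass_ne_top μ₂
  unfold realEnergy
  rw [S.inter_add_left, S.inter_smul_left, S.inter_smul_left, S.mass_add, S.mass_smul,
    S.mass_smul, ENNReal.toReal_add (by finiteness) (by finiteness),
    ENNReal.toReal_add (by finiteness) (by finiteness)]
  simp only [ENNReal.toReal_mul, ENNReal.coe_toReal]
  ring

end KernelShift

end Shift

variable {X ι : Type*} [TopologicalSpace X] [T2Space X] [LocallyCompactSpace X]
  [MeasurableSpace X] [BorelSpace X] {κ : X → X → EReal}

/-! ### Interior capacity -/

lemma regular_restrict_of_isCompact (μ : Measure X) [μ.Regular] {K : Set X} (hK : IsCompact K) :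
    (μ.restrict K).Regular := by
  have : Fact (μ K < ⊤) := ⟨hK.measure_lt_top⟩
  infer_instance

namespace KernelShift

variable (S : KernelShift κ)

/-- The interior capacity of `E` vanishes if and only if no probability measure on a compact subset
of `E` has finite energy. -/
lemma interiorCapacity_eq_zero_iff {E : Set X} :
    interiorCapacity κ E = 0 ↔ ∀ K : Set X, IsCompact K → K ⊆ E → ∀ ν : Measure X, ν.Regular →
      ν Kᶜ = 0 → ν K = 1 → S.inter ν ν = ⊤ := by
  simp only [interiorCapacity, compactCapacity, ENNReal.iSup_eq_zero, ENNReal.inv_eq_zero,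
    iInf_eq_top, EReal.toENNReal_eq_top_iff, and_imp]
  constructor
  · intro h K hK hKE ν hν h0 h1
    exact S.energy_eq_top_iff.1 (h K hK hKE ν hν h0 h1)
  · intro h K hK hKE ν hν h0 h1
    exact S.energy_eq_top_iff.2 (h K hK hKE ν hν h0 h1)

lemma measure_eq_zero_of_isCompact {E K : Set X} (hE : interiorCapacity κ E = 0)
    (hK : IsCompact K) (hKE : K ⊆ E) (ν : Measure X) [ν.Regular] (hν : S.inter ν ν ≠ ⊤) :
    ν K = 0 := by
  by_contra h0
  have htop : ν K ≠ ⊤ := hK.measure_ne_top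
  have hreg := regular_restrict_of_isCompact ν hK
  set t : ℝ≥0 := (ν K)⁻¹.toNNReal with ht
  have htc : (t : ℝ≥0∞) = (ν K)⁻¹ := ENNReal.coe_toNNReal (ENNReal.inv_ne_top.2 h0)
  have h := (S.interiorCapacity_eq_zero_iff.1 hE) K hK hKE (t • ν.restrict K) inferInstance
    (by simp [Measure.restrict_apply hK.measurableSet.compl])
    (by
      rw [Measure.smul_apply, Measure.restrict_apply_self, ENNReal.smul_def, htc, smul_eq_mul,
        ENNReal.inv_mul_cancel h0 htop])
  rw [S.inter_smul_left, S.inter_comm, S.inter_smul_left] at h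
  have hle : S.inter (ν.restrict K) (ν.restrict K) ≠ ⊤ :=
    ne_top_of_le_ne_top hν (S.inter_mono Measure.restrict_le_self Measure.restrict_le_self)
  exact ENNReal.mul_ne_top ENNReal.coe_ne_top (ENNReal.mul_ne_top ENNReal.coe_ne_top hle) h

/-- Measures of finite energy do not charge sets of interior capacity zero. -/
lemma measure_eq_zero_of_interiorCapacity_eq_zero {E T : Set X} (hE : interiorCapacity κ E = 0)
    (ν : Measure X) [ν.Regular] [SigmaFinite ν] (hν : S.inter ν ν ≠ ⊤)
    (hT : NullMeasurableSet T ν) (hTE : T ⊆ E) : ν T = 0 := by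
  obtain ⟨T', hT'T, hT', hae⟩ := hT.exists_measurable_subset_ae_eq
  rw [← measure_congr hae]
  by_contra h0
  obtain ⟨K, hKT, hK, hpos⟩ := hT'.exists_lt_isCompact (pos_iff_ne_zero.2 h0)
  exact hpos.ne' (S.measure_eq_zero_of_isCompact hE hK (hKT.trans (hT'T.trans hTE)) ν hν)

end KernelShift

lemma sigmaFinite_of_setLIntegral_ne_top (μ : Measure X) {A : Set X} (hA : IsClosed A)
    (hμA : μ Aᶜ = 0) {g : X → ℝ} (hg : ContinuousOn g A) (hpos : ∀ x ∈ A, 0 < g x)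
    (hfin : ∫⁻ x in A, ENNReal.ofReal (g x) ∂μ ≠ ⊤) : SigmaFinite μ := by
  have hgm : AEMeasurable g (μ.restrict A) := hg.aemeasurable hA.measurableSet
  refine Measure.sigmaFinite_of_countable
    (S := insert Aᶜ (range fun n : ℕ => A ∩ {x | ((n : ℝ≥0∞) + 1)⁻¹ ≤ ENNReal.ofReal (g x)}))
    ((countable_range _).insert _) ?_ ?_
  · rintro s (rfl | ⟨n, rfl⟩)
    · rw [hμA]; exact ENNReal.zero_lt_top
    · have h1 := meas_ge_le_lintegral_div hgm.ennreal_ofReal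
        (ε := ((n : ℝ≥0∞) + 1)⁻¹) (by simp) (by simp)
      rw [Measure.restrict_apply' hA.measurableSet, inter_comm] at h1
      exact h1.trans_lt (ENNReal.div_lt_top hfin (by simp))
  · rw [eq_univ_iff_forall]
    intro x
    by_cases hx : x ∈ A
    · obtain ⟨n, hn⟩ := ENNReal.exists_inv_nat_lt (ENNReal.ofReal_pos.2 (hpos x hx)).ne'
      refine ⟨_, Or.inr ⟨n, rfl⟩, hx, le_trans ?_ hn.le⟩
      exact ENNReal.inv_le_inv.2 le_self_add
    · exact ⟨_, Or.inl rfl, hx⟩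

/-! ### Energies and potentials of vector measures -/

lemma Condenser.sign_mul_self (A : Condenser X ι) (i : ι) : A.sign i * A.sign i = 1 := by
  rcases A.sign_eq i with h | h <;> simp [h]

lemma Condenser.abs_sign (A : Condenser X ι) (i : ι) : |A.sign i| = 1 := by
  rcases A.sign_eq i with h | h <;> simp [h]

lemma Condenser.abs_sign_mul (A : Condenser X ι) (i j : ι) : |A.sign i * A.sign j| = 1 := by
  rw [abs_mul, A.abs_sign, A.abs_sign, one_mul]

lemma Condenser.finite_of_compactSpace (hX : CompactSpace X) (A : Condenser X ι) : Finite ι := by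
  have h := A.locallyFinite univ isCompact_univ
  have : {i | (A.plate i ∩ univ).Nonempty} = univ := by
    ext i; simp [A.nonempty i]
  rw [this] at h
  exact finite_univ_iff.1 h

namespace KernelShift

variable (S : KernelShift κ)

lemma c_eq_zero_or_finite (A : Condenser X ι) : S.c = 0 ∨ Finite ι :=
  S.c_eq_zero_or.imp_right fun h => A.finite_of_compactSpace h

lemma summable_mul_mass (A : Condenser X ι) (b : ι → ℝ) (μ : ι → Measure X) :
    Summable fun i => b i * (S.mass (μ i)).toReal := by
  rcases S.c_eq_zero_or_finite A with h | h
  · simp [mass, h]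
  · exact Summable.of_finite

lemma summable_mass_mul_mass (A : Condenser X ι) (μ : ι → Measure X) :
    Summable fun p : ι × ι => (S.mass (μ p.1)).toReal * (S.mass (μ p.2)).toReal := by
  rcases S.c_eq_zero_or_finite A with h | h
  · simp [mass, h]
  · exact Summable.of_finite

lemma summable_realEnergy (A : Condenser X ι) {μ : ι → Measure X}
    (h : ∑' p : ι × ι, S.inter (μ p.1) (μ p.2) ≠ ⊤) :
    Summable fun p : ι × ι => A.sign p.1 * A.sign p.2 * S.realEnergy (μ p.1) (μ p.2) := by
  have h1 : Summable fun p : ι × ι => S.realEnergy (μ p.1) (μ p.2) :=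
    (ENNReal.summable_toReal h).sub (S.summable_mass_mul_mass A μ)
  refine Summable.of_norm ((h1.norm).congr fun p => ?_)
  rw [norm_mul, Real.norm_eq_abs (_ * _), A.abs_sign_mul, one_mul]

lemma vectorEnergy_eq (A : Condenser X ι) {μ : ι → Measure X} [∀ i, (μ i).Regular]
    (h : ∑' p : ι × ι, S.inter (μ p.1) (μ p.2) ≠ ⊤) :
    ESumFinite (energyTerm κ A μ) ∧ vectorEnergy κ A μ =
      ((∑' p : ι × ι, A.sign p.1 * A.sign p.2 * S.realEnergy (μ p.1) (μ p.2) : ℝ) : EReal) := by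
  have h1 : energyTerm κ A μ = fun p : ι × ι =>
      ((A.sign p.1 * A.sign p.2 * S.realEnergy (μ p.1) (μ p.2) : ℝ) : EReal) := by
    ext p
    rw [energyTerm, S.energy_eq_coe (ENNReal.ne_top_of_tsum_ne_top h p), ← EReal.coe_mul]
  rw [vectorEnergy, h1]
  exact esum_of_summable (S.summable_realEnergy A h)

/-- Absolute convergence of the energy of a vector measure passes to the nonnegative kernel. -/
lemma tsum_inter_ne_top (A : Condenser X ι) {μ : ι → Measure X} [∀ i, (μ i).Regular]
    (h : ESumFinite (energyTerm κ A μ)) : ∑' p : ι × ι, S.inter (μ p.1) (μ p.2) ≠ ⊤ := by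
  obtain ⟨r, hr, hrE⟩ := h.exists_summable
  have hfin : ∀ p : ι × ι, S.inter (μ p.1) (μ p.2) ≠ ⊤ := by
    intro p hp
    have h1 := hrE p
    rw [energyTerm, S.energy_eq_top_iff.2 hp] at h1
    rcases A.sign_eq p.1 with h2 | h2 <;> rcases A.sign_eq p.2 with h3 | h3 <;> simp [h2, h3] at h1
  have hsum : Summable fun p : ι × ι => (S.inter (μ p.1) (μ p.2)).toReal := by
    have h2 : Summable fun p : ι × ι => S.realEnergy (μ p.1) (μ p.2) := by
      refine Summable.of_norm ((hr.norm).congr fun p => ?_)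
      have h1 := hrE p
      rw [energyTerm, S.energy_eq_coe (hfin p), ← EReal.coe_mul, EReal.coe_eq_coe_iff] at h1
      rw [← h1, norm_mul, Real.norm_eq_abs (_ * _), A.abs_sign_mul, one_mul]
    refine (h2.add (S.summable_mass_mul_mass A μ)).congr fun p => ?_
    rw [realEnergy, sub_add_cancel]
  have h3 : ∀ p : ι × ι, S.inter (μ p.1) (μ p.2) =
      ENNReal.ofReal (S.inter (μ p.1) (μ p.2)).toReal := fun p =>
    (ENNReal.ofReal_toReal (hfin p)).symm
  rw [tsum_congr h3]
  exact hsum.tsum_ofReal_ne_top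

/-- The potentials of all components of a vector measure of finite energy are jointly integrable
with respect to each measure of finite energy, by positive definiteness applied to finite sums of
the components. -/
lemma tsum_inter_ne_top_of_finite_energy (hκ : IsPosDefKernel κ) {μ : ι → Measure X}
    [∀ i, (μ i).Regular] (h : ∑' p : ι × ι, S.inter (μ p.1) (μ p.2) ≠ ⊤) (τ : Measure X)
    [τ.Regular] (hτ : S.inter τ τ ≠ ⊤) : ∑' k, S.inter τ (μ k) ≠ ⊤ := by
  have hle : ∑' k, S.inter τ (μ k) ≤
      S.inter τ τ + ∑' p : ι × ι, S.inter (μ p.1) (μ p.2) := by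
    rw [ENNReal.tsum_eq_iSup_sum]
    refine iSup_le fun s => ?_
    have h1 : ∑ k ∈ s, S.inter τ (μ k) = S.inter τ (∑ k ∈ s, μ k) := by
      rw [S.inter_comm, S.inter_finset_sum_left]
      exact Finset.sum_congr rfl fun k _ => S.inter_comm _ _
    have h2 : S.inter (∑ k ∈ s, μ k) (∑ k ∈ s, μ k) =
        ∑ p ∈ s ×ˢ s, S.inter (μ p.1) (μ p.2) := by
      rw [S.inter_finset_sum_left, Finset.sum_product]
      refine Finset.sum_congr rfl fun j _ => ?_
      rw [S.inter_comm, S.inter_finset_sum_left]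
      exact Finset.sum_congr rfl fun k _ => S.inter_comm _ _
    rw [h1]
    refine (le_mul_of_one_le_left (zero_le) one_le_two).trans
      ((S.two_mul_inter_le hκ τ (∑ k ∈ s, μ k)).trans ?_)
    rw [h2]
    gcongr
    exact ENNReal.sum_le_tsum _
  exact ne_top_of_le_ne_top (ENNReal.add_ne_top.2 ⟨hτ, h⟩) hle

/-- The potential for `κ` as a real number, where `S.pot ν x ≠ ⊤`. -/
def realPot (ν : Measure X) (x : X) : ℝ := (S.pot ν x).toReal - S.c * (S.mass ν).toReal

lemma summable_realPot (A : Condenser X ι) {μ : ι → Measure X} {x : X}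
    (h : ∑' k, S.pot (μ k) x ≠ ⊤) (i : ι) :
    Summable fun k => A.sign i * A.sign k * S.realPot (μ k) x := by
  have h1 : Summable fun k => S.realPot (μ k) x :=
    (ENNReal.summable_toReal h).sub (S.summable_mul_mass A (fun _ => S.c) μ)
  refine Summable.of_norm ((h1.norm).congr fun k => ?_)
  rw [norm_mul, Real.norm_eq_abs (_ * _), A.abs_sign_mul, one_mul]

lemma vectorPot_eq (A : Condenser X ι) {μ : ι → Measure X} [∀ i, (μ i).Regular] {x : X}
    (h : ∑' k, S.pot (μ k) x ≠ ⊤) (i : ι) :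
    ESumFinite (potTerm κ A μ i x) ∧ vectorPot κ A μ i x =
      ((∑' k, A.sign i * A.sign k * S.realPot (μ k) x : ℝ) : EReal) := by
  have h1 : potTerm κ A μ i x = fun k =>
      ((A.sign i * A.sign k * S.realPot (μ k) x : ℝ) : EReal) := by
    ext k
    rw [potTerm, S.pot_eq, coe_sub_coe_eq_coe_toReal (ENNReal.ne_top_of_tsum_ne_top h k)
      (ENNReal.mul_ne_top ENNReal.coe_ne_top (S.mass_ne_top _)), ← EReal.coe_mul,
      ENNReal.toReal_mul, ENNReal.coe_toReal, realPot]
  rw [vectorPot, h1]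
  exact esum_of_summable (S.summable_realPot A h i)

lemma integrable_realPot (τ ν : Measure X) [τ.Regular] [ν.Regular] (h : S.inter τ ν ≠ ⊤) :
    Integrable (S.realPot ν) τ ∧ ∫ x, S.realPot ν x ∂τ = S.realEnergy τ ν ∧
      ∫ x, ‖S.realPot ν x‖ ∂τ ≤
        (S.inter τ ν).toReal + (S.mass τ).toReal * (S.mass ν).toReal := by
  have h1 : Integrable (fun x => (S.pot ν x).toReal) τ :=
    MeasureTheory.integrable_toReal_of_lintegral_ne_top (S.measurable_pot ν).aemeasurable h
  have hae : ∀ᵐ x ∂τ, S.pot ν x < ⊤ := ae_lt_top (S.measurable_pot ν) h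
  have h2 : ∫ x, (S.pot ν x).toReal ∂τ = (S.inter τ ν).toReal :=
    integral_toReal (S.measurable_pot ν).aemeasurable hae
  have h3 : Integrable (fun _ : X => (S.c : ℝ) * (S.mass ν).toReal) τ := by
    rcases S.c_eq_zero_or with hc | hc
    · simp [hc]
    · have : IsFiniteMeasure τ := ⟨isCompact_univ.measure_lt_top⟩
      exact integrable_const _
  have h4 : ∫ _ : X, (S.c : ℝ) * (S.mass ν).toReal ∂τ = (S.mass τ).toReal * (S.mass ν).toReal := by
    have : (S.mass τ).toReal = S.c * (τ univ).toReal := by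
      rw [mass, ENNReal.toReal_mul, ENNReal.coe_toReal]
    rw [integral_const, this, smul_eq_mul, measureReal_def]
    ring
  refine ⟨h1.sub h3, ?_, ?_⟩
  · unfold realPot
    rw [integral_sub h1 h3, h2, h4, realEnergy]
  · rw [← h2, ← h4, ← integral_add h1 h3]
    refine integral_mono (h1.sub h3).norm (h1.add h3) fun x => ?_
    refine (norm_sub_le _ _).trans_eq ?_
    rw [Real.norm_of_nonneg ENNReal.toReal_nonneg,
      Real.norm_of_nonneg (mul_nonneg S.c.coe_nonneg ENNReal.toReal_nonneg)]

/-- Termwise integration of the vector potential. -/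
lemma integral_tsum_realPot [Countable ι] (A : Condenser X ι) {μ : ι → Measure X}
    [∀ i, (μ i).Regular] (τ : Measure X) [τ.Regular] (h : ∑' k, S.inter τ (μ k) ≠ ⊤) (i : ι) :
    Integrable (fun x => ∑' k, A.sign i * A.sign k * S.realPot (μ k) x) τ ∧
      HasSum (fun k => A.sign i * A.sign k * S.realEnergy τ (μ k))
        (∫ x, ∑' k, A.sign i * A.sign k * S.realPot (μ k) x ∂τ) := by
  have hi := fun k => S.integrable_realPot τ (μ k) (ENNReal.ne_top_of_tsum_ne_top h k)
  have hint : ∀ k, Integrable (fun x => A.sign i * A.sign k * S.realPot (μ k) x) τ :=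
    fun k => (hi k).1.const_mul _
  have hnorm : Summable fun k => ∫ x, ‖A.sign i * A.sign k * S.realPot (μ k) x‖ ∂τ := by
    refine Summable.of_nonneg_of_le (fun k => integral_nonneg fun x => norm_nonneg _) (fun k => ?_)
      ((ENNReal.summable_toReal h).add
        (S.summable_mul_mass A (fun _ => (S.mass τ).toReal) μ))
    refine le_trans (le_of_eq ?_) (hi k).2.2
    congr 1
    ext x
    rw [norm_mul, Real.norm_eq_abs (_ * _), A.abs_sign_mul, one_mul]
  refine ⟨⟨AEMeasurable.aestronglyMeasurable (AEMeasurable.tsum fun k => (hint k).aemeasurable),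
    ?_⟩, ?_⟩
  · refine (lintegral_mono fun x => enorm_tsum_le_tsum_enorm).trans_lt ?_
    rw [lintegral_tsum fun k => (hint k).1.enorm]
    simp_rw [← fun k => ofReal_integral_norm_eq_lintegral_enorm (hint k)]
    exact hnorm.tsum_ofReal_lt_top
  · have h2 := hasSum_integral_of_summable_integral_norm hint hnorm
    simpa only [integral_const_mul, (hi _).2.1] using h2

end KernelShift

/-! ### External fields and weighted potentials -/

/-- The external field as a real function, where both of its parts are finite. -/
def ExternalField.real (f : ExternalField X ι) (i : ι) (x : X) : ℝ :=
  (f.fst i x).toReal - (f.snd i x).toReal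

lemma ExternalField.measurable_fst (f : ExternalField X ι) (i : ι) : Measurable (f.fst i) :=
  (f.fst_phi i).1.measurable

lemma ExternalField.measurable_snd (f : ExternalField X ι) (i : ι) : Measurable (f.snd i) :=
  (f.snd_phi i).1.measurable

lemma ExternalField.measurable_val (f : ExternalField X ι) (i : ι) : Measurable (f.val i) := by
  have : Measurable fun x => f.fst i x + -f.snd i x :=
    (f.measurable_fst i).add (continuous_neg.measurable.comp (f.measurable_snd i))
  exact this

lemma ExternalField.measurable_real (f : ExternalField X ι) (i : ι) : Measurable (f.real i) :=
  (f.measurable_fst i).ereal_toReal.sub (f.measurable_snd i).ereal_toReal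

lemma ExternalField.val_eq_coe_real (f : ExternalField X ι) {i : ι} {x : X}
    (h : f.fst i x ≠ ⊤ ∧ f.snd i x ≠ ⊤) : f.val i x = (f.real i x : EReal) := by
  rw [ExternalField.val, ExternalField.real, EReal.coe_sub,
    EReal.coe_toReal h.1 ((f.fst_phi i).2.1 x), EReal.coe_toReal h.2 ((f.snd_phi i).2.1 x)]

lemma ExternalField.mem_dom (f : ExternalField X ι) {i : ι} {x : X} (h : f.snd i x ≠ ⊤) :
    x ∈ f.dom i := fun hx => h hx.2

lemma ExternalField.val_eq_top (f : ExternalField X ι) {i : ι} {x : X} (h₁ : f.fst i x = ⊤)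
    (h₂ : f.snd i x ≠ ⊤) : f.val i x = ⊤ := by
  rw [ExternalField.val, h₁, ← EReal.coe_toReal h₂ ((f.snd_phi i).2.1 x), EReal.top_sub_coe]

lemma ExternalField.ne_top_of_mem_dom (f : ExternalField X ι) {i : ι} {x : X} (hx : x ∈ f.dom i)
    (h₁ : f.val i x ≠ ⊤) (h₂ : f.val i x ≠ ⊥) : f.fst i x ≠ ⊤ ∧ f.snd i x ≠ ⊤ := by
  by_cases hs : f.snd i x = ⊤
  · have hf : f.fst i x ≠ ⊤ := fun hf => hx ⟨hf, hs⟩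
    exact absurd (by rw [ExternalField.val, hs, EReal.sub_top]) h₂
  · exact ⟨fun hf => h₁ (f.val_eq_top hf hs), hs⟩

lemma ExternalField.eIntFinite_iff (f : ExternalField X ι) (i : ι) (ν : Measure X) :
    EIntFinite ν (f.dom i) (f.val i) ↔
      (∀ᵐ x ∂ν, f.fst i x ≠ ⊤ ∧ f.snd i x ≠ ⊤) ∧ Integrable (f.real i) ν := by
  constructor
  · rintro ⟨hdom, hp, hn⟩
    have hval := f.measurable_val i
    have h1 : ∀ᵐ x ∂ν, (f.val i x).toENNReal < ⊤ := ae_lt_top hval.ereal_toENNReal hp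
    have h2 : ∀ᵐ x ∂ν, (-f.val i x).toENNReal < ⊤ :=
      ae_lt_top (continuous_neg.measurable.comp hval).ereal_toENNReal hn
    have hae : ∀ᵐ x ∂ν, f.fst i x ≠ ⊤ ∧ f.snd i x ≠ ⊤ := by
      filter_upwards [hdom, h1, h2] with x hx hx1 hx2
      refine f.ne_top_of_mem_dom hx (fun h => ?_) (fun h => ?_)
      · simp [h] at hx1
      · simp [h] at hx2
    refine ⟨hae, (integrable_toReal_of_lintegral_ne_top
      hval.ereal_toReal.aestronglyMeasurable hp hn).congr (hae.mono fun x hx => ?_)⟩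
    simp only [f.val_eq_coe_real hx, EReal.toReal_coe]
  · rintro ⟨hae, hint⟩
    have h := eint_of_integrable hint (hae.mono fun x hx => f.val_eq_coe_real hx)
    exact ⟨hae.mono fun x hx => f.mem_dom hx.2, h.1, h.2.1⟩

lemma ExternalField.eint_val_eq (f : ExternalField X ι) {i : ι} {ν : Measure X}
    (h : EIntFinite ν (f.dom i) (f.val i)) :
    eint ν (f.val i) = ((∫ x, f.real i x ∂ν : ℝ) : EReal) := by
  obtain ⟨hae, hint⟩ := (f.eIntFinite_iff i ν).1 h
  exact (eint_of_integrable hint (hae.mono fun x hx => f.val_eq_coe_real hx)).2.2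

namespace KernelShift

variable (S : KernelShift κ) (A : Condenser X ι) (f : ExternalField X ι) (μ : ι → Measure X)

/-- The points where all terms of the weighted potential are finite and their sum converges. -/
def goodSet (i : ι) : Set X :=
  {x | ∑' k, S.pot (μ k) x ≠ ⊤ ∧ f.fst i x ≠ ⊤ ∧ f.snd i x ≠ ⊤}

/-- The weighted potential as a real function, to be considered on `KernelShift.goodSet`. -/
def weightedReal (i : ι) (x : X) : ℝ :=
  ∑' k, A.sign i * A.sign k * S.realPot (μ k) x + f.real i x

/-- The integral of the weighted potential `W_μ^i` against `ν`, in terms of mutual energies. -/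
def weightedPairing (i : ι) (ν : Measure X) : ℝ :=
  ∑' k, A.sign i * A.sign k * S.realEnergy ν (μ k) + ∫ x, f.real i x ∂ν

variable [∀ i, (μ i).Regular]

lemma weightedPot_eq {i : ι} {x : X} (hx : x ∈ S.goodSet f μ i) :
    x ∈ weightedDom κ A f μ i ∧
      weightedPot κ A f μ i x = (S.weightedReal A f μ i x : EReal) := by
  obtain ⟨h1, h2⟩ := S.vectorPot_eq A hx.1 i
  have h3 := f.val_eq_coe_real hx.2
  refine ⟨⟨Or.inl h1.1, f.mem_dom hx.2.2, ?_, ?_⟩, ?_⟩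
  · rw [h2]; exact fun h => EReal.coe_ne_top _ h.1
  · rw [h2]; exact fun h => EReal.coe_ne_bot _ h.1
  · rw [weightedPot, h2, h3, ← EReal.coe_add, weightedReal]

lemma weightedPot_eq_top {i : ι} {x : X} (hx : ∑' k, S.pot (μ k) x ≠ ⊤) (h₁ : f.fst i x = ⊤)
    (h₂ : f.snd i x ≠ ⊤) :
    x ∈ weightedDom κ A f μ i ∧ weightedPot κ A f μ i x = ⊤ := by
  obtain ⟨h3, h4⟩ := S.vectorPot_eq A hx i
  refine ⟨⟨Or.inl h3.1, f.mem_dom h₂, ?_, ?_⟩, ?_⟩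
  · rw [h4]; exact fun h => EReal.coe_ne_top _ h.1
  · rw [h4]; exact fun h => EReal.coe_ne_bot _ h.1
  · rw [weightedPot, h4, f.val_eq_top h₁ h₂, EReal.coe_add_top]

variable [Countable ι]

lemma measurable_tsum_pot : Measurable fun x => ∑' k, S.pot (μ k) x :=
  Measurable.tsum fun k => S.measurable_pot (μ k)

lemma ae_tsum_pot_ne_top (ν : Measure X) (h : ∑' k, S.inter ν (μ k) ≠ ⊤) :
    ∀ᵐ x ∂ν, ∑' k, S.pot (μ k) x ≠ ⊤ := by
  refine (ae_lt_top (S.measurable_tsum_pot μ) ?_).mono fun x hx => hx.ne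
  rwa [lintegral_tsum fun k => (S.measurable_pot (μ k)).aemeasurable]

variable {A f μ}

lemma ae_mem_goodSet {i : ι} {ν : Measure X} [ν.Regular] (h : ∑' k, S.inter ν (μ k) ≠ ⊤)
    (hf : EIntFinite ν (f.dom i) (f.val i)) : ∀ᵐ x ∂ν, x ∈ S.goodSet f μ i := by
  filter_upwards [S.ae_tsum_pot_ne_top μ ν h, ((f.eIntFinite_iff i ν).1 hf).1] with x h1 h2
  exact ⟨h1, h2⟩

lemma integral_weightedReal {i : ι} {ν : Measure X} [ν.Regular]
    (h : ∑' k, S.inter ν (μ k) ≠ ⊤) (hf : EIntFinite ν (f.dom i) (f.val i)) :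
    Integrable (S.weightedReal A f μ i) ν ∧
      ∫ x, S.weightedReal A f μ i x ∂ν = S.weightedPairing A f μ i ν := by
  obtain ⟨h1, h2⟩ := S.integral_tsum_realPot A ν h i
  have h3 := ((f.eIntFinite_iff i ν).1 hf).2
  refine ⟨h1.add h3, ?_⟩
  unfold weightedReal weightedPairing
  rw [integral_add h1 h3, h2.tsum_eq]

lemma eint_weightedPot {i : ι} {ν : Measure X} [ν.Regular]
    (h : ∑' k, S.inter ν (μ k) ≠ ⊤) (hf : EIntFinite ν (f.dom i) (f.val i)) :
    EIntFinite ν (weightedDom κ A f μ i) (weightedPot κ A f μ i) ∧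
      eint ν (weightedPot κ A f μ i) = (S.weightedPairing A f μ i ν : EReal) := by
  obtain ⟨h1, h2⟩ := S.integral_weightedReal (A := A) h hf
  have hae := S.ae_mem_goodSet h hf
  have h3 := eint_of_integrable h1 (hae.mono fun x hx => (S.weightedPot_eq A f μ hx).2)
  exact ⟨⟨hae.mono fun x hx => (S.weightedPot_eq A f μ hx).1, h3.1, h3.2.1⟩, h2 ▸ h3.2.2⟩

end KernelShift

/-! ### Varying one component of an equilibrium measure -/

lemma hasSum_ite_fst_eq [DecidableEq ι] (i : ι) {d : ι → ℝ} {D : ℝ} (h : HasSum d D) :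
    HasSum (fun p : ι × ι => if p.1 = i then d p.2 else 0) D := by
  refine (Function.Injective.hasSum_iff (g := fun k : ι => (i, k))
    (fun k l h => (Prod.ext_iff.1 h).2) fun p hp => ?_).1 (by simpa [Function.comp_def] using h)
  rw [if_neg]
  rintro rfl
  exact hp ⟨p.2, rfl⟩

lemma hasSum_ite_snd_eq [DecidableEq ι] (i : ι) {d : ι → ℝ} {D : ℝ} (h : HasSum d D) :
    HasSum (fun p : ι × ι => if p.2 = i then d p.1 else 0) D :=
  (Equiv.prodComm ι ι).hasSum_iff.1 (hasSum_ite_fst_eq i h)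

/-- A quadratic polynomial without constant term that is nonnegative on `(0, 1]` has a nonnegative
linear coefficient. -/
lemma nonneg_of_forall_quadratic_nonneg {q y : ℝ}
    (h : ∀ t : ℝ, 0 < t → t ≤ 1 → 0 ≤ 2 * t * q + t ^ 2 * y) : 0 ≤ q := by
  by_contra! hq
  have hpos : 0 < |y| + 1 := by positivity
  set t := min 1 (-q / (|y| + 1)) with ht
  have ht0 : 0 < t := lt_min one_pos (div_pos (neg_pos.2 hq) hpos)
  have h1 := h t ht0 (min_le_left _ _)
  have h2 : t * (|y| + 1) ≤ -q := by
    rw [← le_div_iff₀ hpos]; exact min_le_right _ _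
  have h3 : 0 ≤ t * (2 * q + t * y) := by linarith [h1, sq t, mul_assoc t t y]
  have h4 : 0 ≤ 2 * q + t * y := nonneg_of_mul_nonneg_right h3 ht0
  nlinarith [le_abs_self y]

namespace KernelShift

variable (S : KernelShift κ) {A : Condenser X ι} {f : ExternalField X ι} {μ : ι → Measure X}
  [∀ i, (μ i).Regular]

instance regular_update [DecidableEq ι] (i : ι) (ν : Measure X) [ν.Regular] (k : ι) :
    (Function.update μ i ν k).Regular := by
  rcases eq_or_ne k i with rfl | h
  · rw [Function.update_self]; infer_instance
  · rw [Function.update_of_ne h]; infer_instance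

lemma inter_comb_ne_top {s t : ℝ≥0} {μ₁ μ₂ ν : Measure X} (h₁ : S.inter μ₁ ν ≠ ⊤)
    (h₂ : S.inter μ₂ ν ≠ ⊤) : S.inter (s • μ₁ + t • μ₂) ν ≠ ⊤ := by
  rw [S.inter_add_left, S.inter_smul_left, S.inter_smul_left]
  exact ENNReal.add_ne_top.2 ⟨ENNReal.mul_ne_top ENNReal.coe_ne_top h₁,
    ENNReal.mul_ne_top ENNReal.coe_ne_top h₂⟩

lemma tsum_inter_update_ne_top [DecidableEq ι]
    (h : ∑' p : ι × ι, S.inter (μ p.1) (μ p.2) ≠ ⊤) (i : ι) (ν : Measure X) [ν.Regular]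
    (hν : S.inter ν ν ≠ ⊤) (hνμ : ∑' k, S.inter ν (μ k) ≠ ⊤) :
    ∑' p : ι × ι,
      S.inter (Function.update μ i ν p.1) (Function.update μ i ν p.2) ≠ ⊤ := by
  have hle : ∀ p : ι × ι, S.inter (Function.update μ i ν p.1) (Function.update μ i ν p.2) ≤
      S.inter (μ p.1) (μ p.2) + ((if p.1 = i then S.inter ν (μ p.2) else 0) +
        ((if p.2 = i then S.inter ν (μ p.1) else 0) + if p = (i, i) then S.inter ν ν else 0)) := by
    rintro ⟨j, k⟩
    rcases eq_or_ne j i with rfl | hj <;> rcases eq_or_ne k j with rfl | hk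
    · simp only [Function.update_self, if_true]
      exact le_add_of_le_right (le_add_of_le_right le_add_self)
    · simp only [Function.update_self, Function.update_of_ne hk, if_true]
      exact le_add_of_le_right le_self_add
    · simp only [Function.update_of_ne hj]
      exact le_self_add
    · rcases eq_or_ne k i with rfl | hki
      · simp only [Function.update_self, Function.update_of_ne hj, if_true, if_neg hj, zero_add]
        rw [S.inter_comm]
        exact le_add_of_le_right le_self_add
      · simp only [Function.update_of_ne hj, Function.update_of_ne hki]
        exact le_self_add
  refine ne_top_of_le_ne_top ?_ (ENNReal.tsum_le_tsum hle)
  rw [ENNReal.tsum_add, ENNReal.tsum_add, ENNReal.tsum_add, tsum_ite_eq]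
  refine ENNReal.add_ne_top.2 ⟨h, ENNReal.add_ne_top.2 ⟨?_, ENNReal.add_ne_top.2 ⟨?_, hν⟩⟩⟩
  · rw [ENNReal.tsum_prod', ENNReal.tsum_comm]
    simpa [tsum_ite_eq] using hνμ
  · rw [ENNReal.tsum_prod']
    simpa [tsum_ite_eq] using hνμ

/-- The energy of a vector measure is a quadratic polynomial along a segment on which one component
varies. -/
lemma hasSum_realEnergy_update [DecidableEq ι]
    (h : ∑' p : ι × ι, S.inter (μ p.1) (μ p.2) ≠ ⊤) (i : ι) (τ : Measure X) [τ.Regular]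
    (hτ : S.inter τ τ ≠ ⊤) (hτμ : ∑' k, S.inter τ (μ k) ≠ ⊤) {s t : ℝ≥0} (hst : s + t = 1) :
    HasSum (fun p : ι × ι => A.sign p.1 * A.sign p.2 *
        S.realEnergy (Function.update μ i (s • μ i + t • τ) p.1)
          (Function.update μ i (s • μ i + t • τ) p.2))
      (∑' p : ι × ι, A.sign p.1 * A.sign p.2 * S.realEnergy (μ p.1) (μ p.2) +
        2 * t * (∑' k, A.sign i * A.sign k * S.realEnergy τ (μ k) -
          ∑' k, A.sign i * A.sign k * S.realEnergy (μ i) (μ k)) +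
        t ^ 2 * (S.realEnergy τ τ - 2 * S.realEnergy τ (μ i) + S.realEnergy (μ i) (μ i))) := by
  have hfin : ∀ j k, S.inter (μ j) (μ k) ≠ ⊤ := fun j k =>
    ENNReal.ne_top_of_tsum_ne_top h (j, k)
  have hfin' : ∀ k, S.inter τ (μ k) ≠ ⊤ := ENNReal.ne_top_of_tsum_ne_top hτμ
  have hs : (s : ℝ) = 1 - t := by
    have : (s : ℝ) + t = 1 := by exact_mod_cast hst
    linarith
  have hE := (S.summable_realEnergy A h).hasSum
  have hrow : Summable fun k => A.sign i * A.sign k * S.realEnergy (μ i) (μ k) :=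
    (S.summable_realEnergy A h).comp_injective (i := fun k : ι => (i, k))
      fun k l h => (Prod.ext_iff.1 h).2
  have hrow' : Summable fun k => A.sign i * A.sign k * S.realEnergy τ (μ k) := by
    have h1 : Summable fun k => S.realEnergy τ (μ k) :=
      (ENNReal.summable_toReal hτμ).sub (S.summable_mul_mass A (fun _ => (S.mass τ).toReal) μ)
    refine Summable.of_norm ((h1.norm).congr fun k => ?_)
    rw [norm_mul, Real.norm_eq_abs (_ * _), A.abs_sign_mul, one_mul]
  have hd := (hrow'.hasSum.sub hrow.hasSum).mul_left (t : ℝ)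
  have hsum := ((hE.add (hasSum_ite_fst_eq i hd)).add (hasSum_ite_snd_eq i hd)).add
    (hasSum_ite_eq (i, i)
      ((t : ℝ) ^ 2 * (S.realEnergy τ τ - 2 * S.realEnergy τ (μ i) + S.realEnergy (μ i) (μ i))))
  have hrowEnergy : ∀ k, S.realEnergy (s • μ i + t • τ) (μ k) =
      s * S.realEnergy (μ i) (μ k) + t * S.realEnergy τ (μ k) := fun k =>
    S.realEnergy_comb_left (hfin i k) (hfin' k)
  have hlτ : S.inter (μ i) τ ≠ ⊤ := S.inter_comm τ (μ i) ▸ hfin' i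
  have hself : S.realEnergy (s • μ i + t • τ) (s • μ i + t • τ) =
      s * (s * S.realEnergy (μ i) (μ i) + t * S.realEnergy τ (μ i)) +
        t * (s * S.realEnergy τ (μ i) + t * S.realEnergy τ τ) := by
    have h1 := S.inter_comb_ne_top (s := s) (t := t) (hfin i i) (hfin' i)
    have h2 := S.inter_comb_ne_top (s := s) (t := t) hlτ hτ
    rw [S.realEnergy_comb_left (by rwa [S.inter_comm]) (by rwa [S.inter_comm]),
      S.realEnergy_comm (μ i), S.realEnergy_comm τ (s • μ i + t • τ), hrowEnergy i,
      S.realEnergy_comb_left hlτ hτ, S.realEnergy_comm (μ i) τ]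
  convert! hsum using 1
  · ext ⟨j, k⟩
    rcases eq_or_ne j i with rfl | hj
    · rcases eq_or_ne k j with rfl | hk
      · simp only [Function.update_self, if_true, hself, A.sign_mul_self, hs]
        ring
      · have : (j, k) ≠ (j, j) := fun h => hk (Prod.ext_iff.1 h).2
        simp only [Function.update_self, Function.update_of_ne hk, if_true, if_neg hk, if_neg this,
          hrowEnergy, hs]
        ring
    · have hji : (j, k) ≠ (i, i) := fun h => hj (Prod.ext_iff.1 h).1
      rcases eq_or_ne k i with rfl | hk
      · simp only [Function.update_self, Function.update_of_ne hj, if_true, if_neg hj, if_neg hji]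
        rw [S.realEnergy_comm (μ j), hrowEnergy, hs, S.realEnergy_comm (μ j)]
        ring
      · simp only [Function.update_of_ne hj, Function.update_of_ne hk, if_neg hj, if_neg hk,
          if_neg hji]
        ring
  · ring

/-- Minimality of an equilibrium measure `μ`, tested by moving mass of the component `μ i` to an
admissible competitor `τ`: the derivative of the weighted energy in this direction is
nonnegative. -/
theorem weightedPairing_le [Countable ι] (hκ : IsPosDefKernel κ) {a : ι → ℝ} {g : ι → X → ℝ}
    (hμ : IsEquilibrium κ A a g f μ) (i : ι) (τ : Measure X) [τ.Regular]
    (hτA : τ (A.plate i)ᶜ = 0) (hτ : S.inter τ τ ≠ ⊤)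
    (hτg : ∫⁻ x in A.plate i, ENNReal.ofReal (g i x) ∂τ = ENNReal.ofReal (a i))
    (hτf : EIntFinite τ (f.dom i) (f.val i)) :
    S.weightedPairing A f μ i (μ i) ≤ S.weightedPairing A f μ i τ := by
  classical
  obtain ⟨hadm, hmin⟩ := hμ
  have hE := S.tsum_inter_ne_top A hadm.finiteEnergy
  have hτμ := S.tsum_inter_ne_top_of_finite_energy hκ hE τ hτ
  obtain ⟨F, hF, hFμ⟩ := hadm.finitePairing.2.exists_summable
  have hFi : F i = ∫ x, f.real i x ∂μ i := by
    rw [← EReal.coe_eq_coe_iff, ← hFμ i, f.eint_val_eq (hadm.finitePairing.1 i)]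
  have hμf := (f.eIntFinite_iff i (μ i)).1 (hadm.finitePairing.1 i)
  have hτf' := (f.eIntFinite_iff i τ).1 hτf
  have hμμ : S.inter (μ i) (μ i) ≠ ⊤ := ENNReal.ne_top_of_tsum_ne_top hE (i, i)
  rw [← sub_nonneg]
  refine nonneg_of_forall_quadratic_nonneg (y := S.realEnergy τ τ - 2 * S.realEnergy τ (μ i) +
    S.realEnergy (μ i) (μ i)) fun t' ht0 ht1 => ?_
  lift t' to ℝ≥0 using ht0.le with t ht
  obtain ⟨s, hst⟩ : ∃ s : ℝ≥0, s + t = 1 := ⟨1 - t, tsub_add_cancel_of_le (by exact_mod_cast ht1)⟩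
  have hst' : (s : ℝ≥0∞) + t = 1 := by exact_mod_cast hst
  have hs : (s : ℝ) = 1 - t := by
    have : (s : ℝ) + t = 1 := by exact_mod_cast hst
    linarith
  set ν : Measure X := s • μ i + t • τ with hν
  have hνν : S.inter ν ν ≠ ⊤ := by
    have h1 : S.inter ν (μ i) ≠ ⊤ :=
      S.inter_comb_ne_top hμμ (ENNReal.ne_top_of_tsum_ne_top hτμ i)
    have h2 : S.inter ν τ ≠ ⊤ :=
      S.inter_comb_ne_top (by rw [S.inter_comm]; exact ENNReal.ne_top_of_tsum_ne_top hτμ i) hτ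
    exact S.inter_comb_ne_top (by rwa [S.inter_comm]) (by rwa [S.inter_comm])
  have hνμ := S.tsum_inter_ne_top_of_finite_energy hκ hE ν hνν
  have hE' := S.tsum_inter_update_ne_top hE i ν hνν hνμ
  obtain ⟨hE'fin, hE'eq⟩ := S.vectorEnergy_eq A hE'
  have hνint : Integrable (f.real i) ν :=
    (hμf.2.smul_measure_nnreal).add_measure (hτf'.2.smul_measure_nnreal)
  have hνf : EIntFinite ν (f.dom i) (f.val i) := by
    refine (f.eIntFinite_iff i ν).2 ⟨?_, hνint⟩
    rw [hν, ae_add_measure_iff]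
    exact ⟨Measure.ae_smul_measure hμf.1 _, Measure.ae_smul_measure hτf'.1 _⟩
  have hνval : ∫ x, f.real i x ∂ν = F i + t * (∫ x, f.real i x ∂τ - F i) := by
    rw [hν, integral_add_measure hμf.2.smul_measure_nnreal hτf'.2.smul_measure_nnreal,
      integral_smul_nnreal_measure, integral_smul_nnreal_measure, ← hFi, NNReal.smul_def,
      NNReal.smul_def, smul_eq_mul, smul_eq_mul, hs]
    ring
  have hF' : HasSum (fun k => F k + if k = i then t * (∫ x, f.real i x ∂τ - F i) else 0)
      (∑' k, F k + t * (∫ x, f.real i x ∂τ - F i)) := hF.hasSum.add (hasSum_ite_eq i _)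
  have hterm : (fun k => eint (Function.update μ i ν k) (f.val k)) = fun k =>
      ((F k + if k = i then t * (∫ x, f.real i x ∂τ - F i) else 0 : ℝ) : EReal) := by
    ext k
    rcases eq_or_ne k i with rfl | hk
    · rw [Function.update_self, f.eint_val_eq hνf, hνval, if_pos rfl]
    · rw [Function.update_of_ne hk, hFμ, if_neg hk, add_zero]
  have hadm' : IsAdmissible κ A a g f (Function.update μ i ν) := by
    refine ⟨fun k => ⟨inferInstance, ?_⟩, hE'fin, fun k => ?_, fun k => ?_, ?_⟩
    · rcases eq_or_ne k i with rfl | hk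
      · rw [Function.update_self, hν]
        simp [(hadm.vectorMeasure k).2, hτA]
      · rw [Function.update_of_ne hk]
        exact (hadm.vectorMeasure k).2
    · rcases eq_or_ne k i with rfl | hk
      · rw [Function.update_self, hν, Measure.restrict_add, Measure.restrict_smul,
          Measure.restrict_smul, lintegral_add_measure, lintegral_smul_measure,
          lintegral_smul_measure, hadm.normalized k, hτg, ENNReal.smul_def, ENNReal.smul_def,
          smul_eq_mul, smul_eq_mul, ← add_mul, hst', one_mul]
      · rw [Function.update_of_ne hk]
        exact hadm.normalized k
    · rcases eq_or_ne k i with rfl | hk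
      · rwa [Function.update_self]
      · rw [Function.update_of_ne hk]
        exact hadm.finitePairing.1 k
    · rw [hterm]
      exact (esum_of_summable hF'.summable).1
  have hle := hmin _ hadm'
  have hpair : pairing f μ = ((∑' k, F k : ℝ) : EReal) := by
    rw [pairing, funext hFμ]
    exact (esum_of_summable hF).2
  have hpair' : pairing f (Function.update μ i ν) =
      ((∑' k, F k + t * (∫ x, f.real i x ∂τ - F i) : ℝ) : EReal) := by
    rw [pairing, hterm, (esum_of_summable hF'.summable).2, hF'.tsum_eq]
  rw [weightedEnergy, weightedEnergy, hE'eq, (S.vectorEnergy_eq A hE).2, hpair, hpair',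
    (S.hasSum_realEnergy_update hE i τ hτ hτμ hst).tsum_eq] at hle
  have hle' : ∀ u v u' v' : ℝ, (u : EReal) + 2 * (v : EReal) ≤ (u' : EReal) + 2 * (v' : EReal) →
      u + 2 * v ≤ u' + 2 * v' := by
    intro u v u' v' h
    have h2 : (2 : EReal) = ((2 : ℝ) : EReal) := rfl
    rw [h2] at h
    exact_mod_cast h
  have h1 := hle' _ _ _ _ hle
  unfold weightedPairing
  rw [← hFi]
  linarith

end KernelShift

/-! ### The nearly everywhere infimum of the weighted potential -/

lemma integral_eq_of_setLIntegral_eq {A : Set X} (hA : IsClosed A) {ν : Measure X}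
    (hν : ν Aᶜ = 0) {g : X → ℝ} (hg : ContinuousOn g A) (hpos : ∀ x ∈ A, 0 < g x) {a : ℝ}
    (ha : 0 < a) (h : ∫⁻ x in A, ENNReal.ofReal (g x) ∂ν = ENNReal.ofReal a) :
    Integrable g ν ∧ ∫ x, g x ∂ν = a := by
  have hae : ∀ᵐ x ∂ν, x ∈ A := hν
  have hres : ν.restrict A = ν := Measure.restrict_eq_self_of_ae_mem hae
  have hm : AEMeasurable g ν := hres ▸ hg.aemeasurable hA.measurableSet
  have hnn : 0 ≤ᵐ[ν] g := hae.mono fun x hx => (hpos x hx).le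
  rw [hres] at h
  refine ⟨⟨hm.aestronglyMeasurable, ?_⟩, ?_⟩
  · rw [hasFiniteIntegral_iff_ofReal hnn, h]
    exact ENNReal.ofReal_lt_top
  · rw [integral_eq_lintegral_of_nonneg_ae hnn hm.aestronglyMeasurable, h,
      ENNReal.toReal_ofReal ha.le]

namespace KernelShift

variable (S : KernelShift κ) {A : Condenser X ι} {f : ExternalField X ι} {μ : ι → Measure X}
  [∀ i, (μ i).Regular] {a : ι → ℝ} {g : ι → X → ℝ}

lemma quotient_eq_coe {i : ι} {x : X} (hx : x ∈ S.goodSet f μ i) :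
    (a i : EReal) * weightedPot κ A f μ i x / (g i x : EReal) =
      ((a i * S.weightedReal A f μ i x / g i x : ℝ) : EReal) := by
  rw [(S.weightedPot_eq A f μ hx).2, EReal.coe_div, EReal.coe_mul]

variable [Countable ι]

/-- A failure of the lower bound on a set of positive capacity would yield a competitor carried by
this set, of finite energy and with bounded external field, which contradicts minimality. -/
theorem nearlyEverywhere_weightedPairing_le (hκ : IsPosDefKernel κ) (ha : ∀ i, 0 < a i)
    (hg : ∀ i, ContinuousOn (g i) (A.plate i)) (hg_pos : ∀ i, ∀ x ∈ A.plate i, 0 < g i x)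
    (hf : ∀ i, NearlyEverywhere κ univ (fun x => f.snd i x ≠ ⊤))
    (hμ : IsEquilibrium κ A a g f μ) (i : ι) :
    NearlyEverywhere κ (A.plate i) (fun x => x ∈ weightedDom κ A f μ i ∧
      (S.weightedPairing A f μ i (μ i) : EReal) ≤
        (a i : EReal) * weightedPot κ A f μ i x / (g i x : EReal)) := by
  set w := S.weightedPairing A f μ i (μ i) with hw
  have hE := S.tsum_inter_ne_top A hμ.1.finiteEnergy
  refine S.interiorCapacity_eq_zero_iff.2 fun K hK hKE ν hνreg hνK hνK1 => ?_
  by_contra hνν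
  have hfinν : IsFiniteMeasure ν := by
    refine ⟨?_⟩
    rw [← union_compl_self K]
    refine (measure_union_le _ _).trans_lt ?_
    rw [hνK, hνK1]
    simp
  have hae1 := S.ae_tsum_pot_ne_top μ ν (S.tsum_inter_ne_top_of_finite_energy hκ hE ν hνν)
  have hae2 : ∀ᵐ x ∂ν, f.snd i x ≠ ⊤ := by
    refine S.measure_eq_zero_of_interiorCapacity_eq_zero (hf i) ν hνν
      (MeasurableSet.nullMeasurableSet ?_) (fun x hx => ⟨mem_univ x, hx⟩)
    exact (f.measurable_snd i (measurableSet_singleton ⊤)).compl.compl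
  have hgood : ∀ x ∈ K, ∑' k, S.pot (μ k) x ≠ ⊤ → f.snd i x ≠ ⊤ → x ∈ S.goodSet f μ i := by
    intro x hx h1 h2
    refine ⟨h1, fun h3 => (hKE hx).2 ?_, h2⟩
    obtain ⟨h4, h5⟩ := S.weightedPot_eq_top A f μ h1 h3 h2
    refine ⟨h4, ?_⟩
    rw [h5, EReal.coe_mul_top_of_pos (ha i), EReal.top_div_of_pos_ne_top
      (by exact_mod_cast hg_pos i x (hKE hx).1) (EReal.coe_ne_top _)]
    exact le_top
  have hlt : ∀ x ∈ K, x ∈ S.goodSet f μ i → S.weightedReal A f μ i x < w / a i * g i x := by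
    intro x hx h1
    by_contra! h2
    refine (hKE hx).2 ⟨(S.weightedPot_eq A f μ h1).1, ?_⟩
    have hgx := hg_pos i x (hKE hx).1
    rw [S.quotient_eq_coe h1, EReal.coe_le_coe_iff, le_div_iff₀ hgx]
    have h3 := mul_le_mul_of_nonneg_left h2 (ha i).le
    have h4 : a i * (w / a i * g i x) = w * g i x := by
      field_simp [(ha i).ne']
    linarith
  -- a compact set of positive measure on which the external field is bounded
  obtain ⟨n, hn⟩ : ∃ n : ℕ, ν (K ∩ {x | (f.fst i x ≠ ⊤ ∧ f.snd i x ≠ ⊤) ∧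
      |f.real i x| ≤ n}) ≠ 0 := by
    by_contra! hcon
    have h1 := measure_iUnion_null hcon
    have h2 : ∀ᵐ x ∂ν, x ∉ K := by
      filter_upwards [hae1, hae2, measure_eq_zero_iff_ae_notMem.1 h1] with x hx1 hx2 hx3 hxK
      obtain ⟨n, hn⟩ := exists_nat_ge |f.real i x|
      exact hx3 (mem_iUnion.2 ⟨n, hxK, (hgood x hxK hx1 hx2).2, hn⟩)
    rw [measure_eq_zero_iff_ae_notMem.2 h2] at hνK1
    exact zero_ne_one hνK1
  have hTm : MeasurableSet (K ∩ {x | (f.fst i x ≠ ⊤ ∧ f.snd i x ≠ ⊤) ∧ |f.real i x| ≤ n}) := by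
    refine hK.measurableSet.inter (MeasurableSet.inter (MeasurableSet.inter ?_ ?_) ?_)
    · exact (f.measurable_fst i (measurableSet_singleton ⊤)).compl
    · exact (f.measurable_snd i (measurableSet_singleton ⊤)).compl
    · exact measurableSet_le (f.measurable_real i).abs measurable_const
  obtain ⟨L, hLT, hL, hLpos⟩ := hTm.exists_lt_isCompact (pos_iff_ne_zero.2 hn)
  have hLA : L ⊆ A.plate i := fun x hx => (hKE (hLT hx).1).1
  have hregL := regular_restrict_of_isCompact ν hL
  set ρ := ν.restrict L with hρ
  have hρA : ρ (A.plate i)ᶜ = 0 := by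
    rw [hρ, Measure.restrict_apply (A.closed i).measurableSet.compl,
      (disjoint_compl_left_iff_subset.2 hLA).inter_eq, measure_empty]
  have hρres : ρ.restrict (A.plate i) = ρ := Measure.restrict_eq_self_of_ae_mem hρA
  have hρL : ∀ᵐ x ∂ρ, x ∈ L := ae_restrict_mem hL.measurableSet
  have hgL : Integrable (g i) ρ := ((hg i).mono hLA).integrableOn_compact hL
  have hG0 : ∫⁻ x, ENNReal.ofReal (g i x) ∂ρ ≠ 0 := by
    intro h0
    rw [lintegral_eq_zero_iff' hgL.1.aemeasurable.ennreal_ofReal] at h0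
    have : ∀ᵐ x ∂ρ, False := by
      filter_upwards [h0, hρL] with x h1 h2
      exact (hg_pos i x (hLA h2)).not_ge (ENNReal.ofReal_eq_zero.1 h1)
    rw [eventually_false_iff_eq_bot, ae_eq_bot, hρ, Measure.restrict_eq_zero] at this
    exact hLpos.ne' this
  have hGtop : ∫⁻ x, ENNReal.ofReal (g i x) ∂ρ ≠ ⊤ := hgL.lintegral_lt_top.ne
  -- the competitor is `t • ρ`, scaled so that its integral of `g i` is `a i`
  set t : ℝ≥0 := (ENNReal.ofReal (a i) / ∫⁻ x, ENNReal.ofReal (g i x) ∂ρ).toNNReal with ht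
  have htc : (t : ℝ≥0∞) = ENNReal.ofReal (a i) / ∫⁻ x, ENNReal.ofReal (g i x) ∂ρ :=
    ENNReal.coe_toNNReal (ENNReal.div_ne_top ENNReal.ofReal_ne_top hG0)
  have hρρ : S.inter ρ ρ ≠ ⊤ :=
    ne_top_of_le_ne_top hνν (S.inter_mono Measure.restrict_le_self Measure.restrict_le_self)
  have hττ : S.inter (t • ρ) (t • ρ) ≠ ⊤ := by
    rw [S.inter_smul_left, S.inter_comm, S.inter_smul_left]
    finiteness
  have hτA : (t • ρ) (A.plate i)ᶜ = 0 := by simp [hρA]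
  have hτg : ∫⁻ x in A.plate i, ENNReal.ofReal (g i x) ∂(t • ρ) = ENNReal.ofReal (a i) := by
    rw [Measure.restrict_smul, hρres, lintegral_smul_measure, ENNReal.smul_def, htc, smul_eq_mul,
      ENNReal.div_mul_cancel hG0 hGtop]
  have hρf : EIntFinite (t • ρ) (f.dom i) (f.val i) := by
    refine (f.eIntFinite_iff i _).2 ⟨Measure.ae_smul_measure
      (hρL.mono fun x hx => (hLT hx).2.1) _, Integrable.smul_measure_nnreal ?_⟩
    have hfinL : IsFiniteMeasure ρ := inferInstanceAs (IsFiniteMeasure (ν.restrict L))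
    exact Integrable.of_bound (f.measurable_real i).aestronglyMeasurable n
      (hρL.mono fun x hx => (hLT hx).2.2)
  have hle := S.weightedPairing_le hκ hμ i (t • ρ) hτA hττ hτg hρf
  have hτμ := S.tsum_inter_ne_top_of_finite_energy hκ hE (t • ρ) hττ
  obtain ⟨hWint, hWeq⟩ := S.integral_weightedReal (A := A) hτμ hρf
  obtain ⟨hgint, hgeq⟩ := integral_eq_of_setLIntegral_eq (A.closed i) hτA (hg i) (hg_pos i)
    (ha i) hτg
  have hae : ∀ᵐ x ∂(t • ρ), S.weightedReal A f μ i x < w / a i * g i x := by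
    filter_upwards [S.ae_mem_goodSet hτμ hρf, Measure.ae_smul_measure hρL t] with x h1 h2
    exact hlt x (hLT h2).1 h1
  have hint : ∫ x, (w / a i * g i x - S.weightedReal A f μ i x) ∂(t • ρ) ≤ 0 := by
    rw [integral_sub (hgint.const_mul _) hWint, integral_const_mul, hgeq, hWeq,
      div_mul_cancel₀ _ (ha i).ne']
    linarith
  have hnn : 0 ≤ᵐ[t • ρ] fun x => w / a i * g i x - S.weightedReal A f μ i x :=
    hae.mono fun x hx => sub_nonneg.2 hx.le
  have h0 := (integral_eq_zero_iff_of_nonneg_ae hnn ((hgint.const_mul _).sub hWint)).1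
    (le_antisymm hint (integral_nonneg_of_ae hnn))
  have hfalse : ∀ᵐ x ∂(t • ρ), False := by
    filter_upwards [h0, hae] with x h1 h2
    exact (sub_pos.2 h2).ne' h1
  rw [eventually_false_iff_eq_bot, ae_eq_bot] at hfalse
  rw [hfalse, integral_zero_measure] at hgeq
  exact (ha i).ne hgeq

/-- Any nearly everywhere lower bound holds almost everywhere for the component `μ i`, since its
energy is finite, and may be integrated. -/
lemma le_weightedPairing_of_nearlyEverywhere (ha : ∀ i, 0 < a i)
    (hg : ∀ i, ContinuousOn (g i) (A.plate i)) (hg_pos : ∀ i, ∀ x ∈ A.plate i, 0 < g i x)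
    (hμ : IsAdmissible κ A a g f μ) (i : ι) {q : ℝ}
    (hq : NearlyEverywhere κ (A.plate i) (fun x => x ∈ weightedDom κ A f μ i ∧
      (q : EReal) ≤ (a i : EReal) * weightedPot κ A f μ i x / (g i x : EReal))) :
    q ≤ S.weightedPairing A f μ i (μ i) := by
  have hE := S.tsum_inter_ne_top A hμ.finiteEnergy
  have hrow : ∑' k, S.inter (μ i) (μ k) ≠ ⊤ :=
    ne_top_of_le_ne_top hE (ENNReal.tsum_comp_le_tsum_of_injective
      (f := fun k : ι => (i, k)) (fun k l h => (Prod.ext_iff.1 h).2)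
      fun p : ι × ι => S.inter (μ p.1) (μ p.2))
  have hsf : SigmaFinite (μ i) := sigmaFinite_of_setLIntegral_ne_top (μ i) (A.closed i)
    (hμ.vectorMeasure i).2 (hg i) (hg_pos i) (by rw [hμ.normalized i]; exact ENNReal.ofReal_ne_top)
  obtain ⟨hWint, hWeq⟩ := S.integral_weightedReal (A := A) hrow (hμ.finitePairing.1 i)
  obtain ⟨hgint, hgeq⟩ := integral_eq_of_setLIntegral_eq (A.closed i) (hμ.vectorMeasure i).2 (hg i)
    (hg_pos i) (ha i) (hμ.normalized i)
  have haeA : ∀ᵐ x ∂μ i, x ∈ A.plate i := (hμ.vectorMeasure i).2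
  have hgood := S.ae_mem_goodSet hrow (hμ.finitePairing.1 i)
  have hT : NullMeasurableSet ({x | x ∈ A.plate i ∧ x ∈ S.goodSet f μ i} ∩
      {x | a i * S.weightedReal A f μ i x / g i x < q}) (μ i) := by
    refine NullMeasurableSet.inter ?_ ?_
    · refine (MeasurableSet.univ.nullMeasurableSet).congr ?_
      filter_upwards [haeA, hgood] with x h1 h2
      exact (eq_true ⟨h1, h2⟩).symm
    · exact nullMeasurableSet_lt ((hWint.1.aemeasurable.const_mul _).div hgint.1.aemeasurable)
        aemeasurable_const
  -- the set where the bound fails is only null measurable, as the weighted potential is only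
  -- almost everywhere measurable
  have hnull := S.measure_eq_zero_of_interiorCapacity_eq_zero hq (μ i)
    (ENNReal.ne_top_of_tsum_ne_top hrow i) hT (by
      rintro x ⟨⟨h1, h2⟩, h3⟩
      refine ⟨h1, fun h4 => ?_⟩
      have h5 := h4.2
      rw [S.quotient_eq_coe h2, EReal.coe_le_coe_iff] at h5
      exact absurd h3 (not_lt.2 h5))
  have hle : ∀ᵐ x ∂μ i, q / a i * g i x ≤ S.weightedReal A f μ i x := by
    filter_upwards [haeA, hgood, measure_eq_zero_iff_ae_notMem.1 hnull] with x h1 h2 h3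
    have h4 : q ≤ a i * S.weightedReal A f μ i x / g i x := by
      by_contra! h4
      exact h3 ⟨⟨h1, h2⟩, h4⟩
    rw [le_div_iff₀ (hg_pos i x h1)] at h4
    rw [div_mul_eq_mul_div, div_le_iff₀ (ha i)]
    linarith
  have h1 := integral_mono_ae (hgint.const_mul _) hWint hle
  rwa [integral_const_mul, hgeq, hWeq, div_mul_cancel₀ _ (ha i).ne'] at h1

lemma interiorCapacity_plate_pos (S : KernelShift κ) (ha : ∀ i, 0 < a i)
    (hg : ∀ i, ContinuousOn (g i) (A.plate i)) (hg_pos : ∀ i, ∀ x ∈ A.plate i, 0 < g i x)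
    (hμ : IsAdmissible κ A a g f μ) (i : ι) : 0 < interiorCapacity κ (A.plate i) := by
  have hE := S.tsum_inter_ne_top A hμ.finiteEnergy
  have hnorm := hμ.normalized i
  have hsf : SigmaFinite (μ i) := sigmaFinite_of_setLIntegral_ne_top (μ i) (A.closed i)
    (hμ.vectorMeasure i).2 (hg i) (hg_pos i) (by rw [hnorm]; exact ENNReal.ofReal_ne_top)
  refine pos_iff_ne_zero.2 fun h0 => ?_
  have h1 := S.measure_eq_zero_of_interiorCapacity_eq_zero h0 (μ i)
    (ENNReal.ne_top_of_tsum_ne_top hE (i, i)) (A.closed i).measurableSet.nullMeasurableSet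
    Subset.rfl
  rw [Measure.restrict_eq_zero.2 h1, lintegral_zero_measure] at hnorm
  exact (ENNReal.ofReal_pos.2 (ha i)).ne hnorm

/-- Since `∫ W_μ^i dμ^i` is the `i`-th row sum of the energy plus `∫ f_i dμ^i`, the sum over `i`
is the energy plus `⟨f, μ⟩`, which is half of the field term in the weighted energy. -/
lemma weightedEnergy_eq (hμ : IsAdmissible κ A a g f μ) :
    ESumFinite (fun i => (S.weightedPairing A f μ i (μ i) : EReal)) ∧
      weightedEnergy κ A f μ =
        esum (fun i => (S.weightedPairing A f μ i (μ i) : EReal)) + pairing f μ := by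
  have hE := S.tsum_inter_ne_top A hμ.finiteEnergy
  have hsum := S.summable_realEnergy A hE
  obtain ⟨F, hF, hFμ⟩ := hμ.finitePairing.2.exists_summable
  have hFi : ∀ i, ∫ x, f.real i x ∂μ i = F i := fun i => by
    rw [← EReal.coe_eq_coe_iff, ← hFμ i, f.eint_val_eq (hμ.finitePairing.1 i)]
  have hw : ∀ i, S.weightedPairing A f μ i (μ i) =
      ∑' k, A.sign i * A.sign k * S.realEnergy (μ i) (μ k) + F i := fun i => by
    rw [weightedPairing, hFi]
  simp_rw [hw]
  have h1 := esum_of_summable (hsum.prod.add hF)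
  refine ⟨h1.1, ?_⟩
  have hpair : pairing f μ = ((∑' k, F k : ℝ) : EReal) := by
    rw [pairing, funext hFμ]
    exact (esum_of_summable hF).2
  rw [h1.2, weightedEnergy, (S.vectorEnergy_eq A hE).2, hpair, hsum.prod.tsum_add hF,
    hsum.tsum_prod]
  have h2 : (2 : EReal) = ((2 : ℝ) : EReal) := rfl
  rw [h2, ← EReal.coe_mul, ← EReal.coe_add, ← EReal.coe_add]
  congr 1
  ring

lemma plateInf_eq (hκ : IsPosDefKernel κ) (ha : ∀ i, 0 < a i)
    (hg : ∀ i, ContinuousOn (g i) (A.plate i)) (hg_pos : ∀ i, ∀ x ∈ A.plate i, 0 < g i x)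
    (hf : ∀ i, NearlyEverywhere κ univ (fun x => f.snd i x ≠ ⊤))
    (hμ : IsEquilibrium κ A a g f μ) (i : ι) :
    plateInf κ A a g f μ i = (S.weightedPairing A f μ i (μ i) : EReal) := by
  refine le_antisymm (sSup_le ?_) (le_sSup ?_)
  · rintro _ ⟨q, hq, rfl⟩
    exact EReal.coe_le_coe_iff.2
      (S.le_weightedPairing_of_nearlyEverywhere ha hg hg_pos hμ.1 i hq)
  · exact ⟨_, S.nearlyEverywhere_weightedPairing_le hκ ha hg hg_pos hf hμ i, rfl⟩

end KernelShift

end GaussProblem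

end

theorem corollary7p3 {X ι : Type*} [TopologicalSpace X] [T2Space X] [LocallyCompactSpace X]
    [MeasurableSpace X] [BorelSpace X] [Countable ι]
    (κ : X → X → EReal) (hκ : GaussProblem.IsPosDefKernel κ)
    (A : GaussProblem.Condenser X ι)
    (a : ι → ℝ) (ha : ∀ i, 0 < a i)
    (g : ι → X → ℝ) (hg : ∀ i, ContinuousOn (g i) (A.plate i))
    (hg_pos : ∀ i, ∀ x ∈ A.plate i, 0 < g i x)
    (f : GaussProblem.ExternalField X ι)
    (hf : ∀ i, GaussProblem.NearlyEverywhere κ Set.univ (fun x => f.snd i x ≠ ⊤))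
    (lam : ι → Measure X) (hlam : GaussProblem.IsEquilibrium κ A a g f lam) :
    (∀ i,
      0 < GaussProblem.interiorCapacity κ (A.plate i) ∧
      GaussProblem.NEBddBelow κ (A.plate i) (GaussProblem.weightedDom κ A f lam i)
        (fun x => (a i : EReal) * GaussProblem.weightedPot κ A f lam i x / (g i x : EReal)) ∧
      GaussProblem.EIntFinite (lam i) (GaussProblem.weightedDom κ A f lam i)
        (GaussProblem.weightedPot κ A f lam i) ∧
      GaussProblem.eint (lam i) (GaussProblem.weightedPot κ A f lam i) =
        GaussProblem.plateInf κ A a g f lam i) ∧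
    GaussProblem.ESumFinite (fun i => GaussProblem.plateInf κ A a g f lam i) ∧
    GaussProblem.weightedEnergy κ A f lam =
      GaussProblem.esum (fun i => GaussProblem.plateInf κ A a g f lam i) +
        GaussProblem.pairing f lam := by
  obtain ⟨S⟩ := hκ.exists_kernelShift
  have hreg : ∀ i, (lam i).Regular := fun i => (hlam.1.vectorMeasure i).1
  have hE := S.tsum_inter_ne_top A hlam.1.finiteEnergy
  simp_rw [S.plateInf_eq hκ ha hg hg_pos hf hlam]
  refine ⟨fun i => ⟨S.interiorCapacity_plate_pos ha hg hg_pos hlam.1 i,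
    ⟨_, S.nearlyEverywhere_weightedPairing_le hκ ha hg hg_pos hf hlam i⟩, ?_⟩,
    S.weightedEnergy_eq hlam.1⟩
  exact S.eint_weightedPot (S.tsum_inter_ne_top_of_finite_energy hκ hE (lam i)
    (ENNReal.ne_top_of_tsum_ne_top hE (i, i))) (hlam.1.finitePairing.1 i)
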